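/- Let $\mathcal M=(\mathcal S,\mathcal A,T,\{l_t\},\{d_t\},\{P_t\}_{t=1}^T)$ be a finite-horizon MDP with finite state and action spaces ($S=|\mathcal S|$, $A=|\mathcal A|$), initial-state law $\mu$, losses and consumptions $l_t,d_t:\mathcal S\times\mathcal A\to[0,1]$ and unknown transition kernels $P_t(\cdot\mid s,a)$. Write $V_r(\pi;P)=\mathbb E[\sum_{t=1}^T r_t(s_t,a_t)\mid \pi,P]$. Let $\pi_{\mathrm{base}}$ be a baseline policy with $b_{\mathrm{base}}=V_d(\pi_{\mathrm{base}};P)<B_0$, put $\gamma=B_0-b_{\mathrm{base}}$, and let $\delta\in(0,1)$ and $L'=\log(2SATK/\delta)$. BALDE is run for episodes $k=1,\dots,K$, with $K_0$ warm-up episodes. At the start of episode $k$ it receives a budget $b_k\in[B_0,T]$, which may depend in any way on the information available at that time. From the visit counts of the preceding episodes it forms $$\hat P_{k,t}(s'|s,a)=\frac{n_{k,t}(s,a,s')}{n_{k,t}(s,a)\vee 1},\qquad \beta^p_{k,t}(s,a,s')=\sqrt{\frac{4\hat P_{k,t}(s'|s,a)(1-\hat P_{k,t}(s'|s,a))L'}{n_{k,t}(s,a)\vee1}}+\frac{14L'/3}{n_{k,t}(s,a)\vee1},$$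 and, with $\beta^p_{k,t}(s,a)=\sum_{s'}\beta^p_{k,t}(s,a,s')$, the inflated consumption $\bar d_{k,t}=d_t+T\beta^p_{k,t}$ and the optimistic loss $\bar l_{k,t}=l_t-T^2\beta^p_{k,t}/(b_k-b_{\mathrm{base}})$. If $k\le K_0$, it plays $\pi_k=\pi_{\mathrm{base}}$. If $k>K_0$, it takes an optimal solution $q$ of the extended linear program: minimize $\sum q_t(s,a,s')\bar l_{k,t}(s,a)$ over $q\ge0$ subject to $\sum q_t(s,a,s')\bar d_{k,t}(s,a)\le b_k$; $\sum_{a,s'}q_1(s,a,s')=\mu(s)$; $\sum_{a,s'}q_t(s,a,s')=\sum_{s'',a''}q_{t-1}(s'',a'',s)$ for $2\le t\le T$; and $(\hat P_{k,t}-\beta^p_{k,t})(s,a,s')\sum_yq_t(s,a,y)\le q_t(s,a,s')\le(\hat P_{k,t}+\beta^p_{k,t})(s,a,s')\sum_yq_t(s,a,y)$. It plays a policy $\pi_k$ with $\pi_{k,t}(a|s)=\sum_{s'}q_t(s,a,s')/\sum_{a',s'}q_t(s,a',s')$ wherever the denominator is nonzero. Should the linear program be infeasible, $\pi_k$ may be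 any policy. The trajectory of episode $k$ is then drawn from $\pi_k$ and $P$. There is a universal constant $C>0$ such that, whenever $K_0\ge C\,\dfrac{S^2AT^4}{\gamma^2}\,(L')^2$, the following holds: with probability at least $1-3\delta$, $V_d(\pi_k;P)\le b_k$ for every $k\in[K]$. -/

import Mathlib

open MeasureTheory

namespace BALDE

noncomputable section

/-- A finite-horizon, possibly time-inhomogeneous Markov decision process with `T` time slots
(slot `t` of the paper-style numbering `1, …, T` is the element `t - 1` of `Fin T`).
`trans t s a` is the law of the next state; the last kernel produces the state that follows
slot `T`. -/
structure MDP (S A : Type*) [Fintype S] [Fintype A] (T : ℕ) where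
  init : S → ℝ
  trans : Fin T → S → A → S → ℝ
  loss : Fin T → S → A → ℝ
  cost : Fin T → S → A → ℝ
  init_mem : init ∈ stdSimplex ℝ S
  trans_mem : ∀ t s a, trans t s a ∈ stdSimplex ℝ S
  loss_mem : ∀ t s a, loss t s a ∈ Set.Icc (0 : ℝ) 1
  cost_mem : ∀ t s a, cost t s a ∈ Set.Icc (0 : ℝ) 1

/-- `π t s a` is the probability of playing `a` in state `s` at slot `t`. -/
def IsPolicy {S A : Type*} [Fintype A] {T : ℕ} (π : Fin T → S → A → ℝ) : Prop :=
  ∀ t s, π t s ∈ stdSimplex ℝ A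

/-- A trajectory `(s_1, a_1, …, s_T, a_T, s_{T+1})` of one episode. -/
abbrev Traj (S A : Type*) (T : ℕ) : Type _ := (Fin (T + 1) → S) × (Fin T → A)

/-- State at slot `t`. -/
def Traj.state {S A : Type*} {T : ℕ} (τ : Traj S A T) (t : Fin T) : S := τ.1 t.castSucc

/-- State right after slot `t`. -/
def Traj.next {S A : Type*} {T : ℕ} (τ : Traj S A T) (t : Fin T) : S := τ.1 t.succ

/-- Action at slot `t`. -/
def Traj.action {S A : Type*} {T : ℕ} (τ : Traj S A T) (t : Fin T) : A := τ.2 t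

/-- Probability of the trajectory `τ` under initial law `μ`, kernels `P` and policy `π`. -/
def trajProb {S A : Type*} {T : ℕ} (μ : S → ℝ) (P : Fin T → S → A → S → ℝ)
    (π : Fin T → S → A → ℝ) (τ : Traj S A T) : ℝ :=
  μ (τ.1 0) * ∏ t : Fin T,
    (π t (τ.state t) (τ.action t) * P t (τ.state t) (τ.action t) (τ.next t))

/-- `V_r(π; P) = E[∑_t r_t(s_t, a_t) | π, P]`. -/
def value {S A : Type*} [Fintype S] [Fintype A] {T : ℕ} (μ : S → ℝ)
    (P : Fin T → S → A → S → ℝ) (r : Fin T → S → A → ℝ) (π : Fin T → S → A → ℝ) : ℝ :=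
  open Classical in
  ∑ τ : Traj S A T, trajProb μ P π τ * ∑ t : Fin T, r t (τ.state t) (τ.action t)

/-- Expected resource consumption `V_d(π; P)` under the true model. -/
def MDP.consumption {S A : Type*} [Fintype S] [Fintype A] {T : ℕ} (M : MDP S A T)
    (π : Fin T → S → A → ℝ) : ℝ :=
  value M.init M.trans M.cost π

section Estimates

variable {S A : Type*} [Fintype S] [Fintype A] [DecidableEq S] [DecidableEq A] {T : ℕ}

/-- `n_{k,t}(s,a)`: visits in the episodes `1, …, k-1` of the history `h`. -/
def visits (h : ℕ → Traj S A T) (k : ℕ) (t : Fin T) (s : S) (a : A) : ℕ :=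
  ((Finset.Ico 1 k).filter fun j => (h j).state t = s ∧ (h j).action t = a).card

/-- `n_{k,t}(s,a,s')`. -/
def visitsNext (h : ℕ → Traj S A T) (k : ℕ) (t : Fin T) (s : S) (a : A) (s' : S) : ℕ :=
  ((Finset.Ico 1 k).filter fun j =>
    (h j).state t = s ∧ (h j).action t = a ∧ (h j).next t = s').card

/-- Empirical transition estimate `n_{k,t}(s,a,s') / (n_{k,t}(s,a) ∨ 1)`. -/
def empTrans (h : ℕ → Traj S A T) (k : ℕ) (t : Fin T) (s : S) (a : A) (s' : S) : ℝ :=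
  (visitsNext h k t s a s' : ℝ) / max (visits h k t s a : ℝ) 1

/-- `L' = log (2 |S| |A| T K / δ)`. -/
def logFactor (S A : Type*) [Fintype S] [Fintype A] (T K : ℕ) (δ : ℝ) : ℝ :=
  Real.log (2 * (Fintype.card S : ℝ) * (Fintype.card A : ℝ) * (T : ℝ) * (K : ℝ) / δ)

/-- Empirical Bernstein radius `β^p_{k,t}(s,a,s')`; the variance of the empirical Bernoulli
law with mean `p` is `p * (1 - p)`. -/
def radius (K : ℕ) (δ : ℝ) (h : ℕ → Traj S A T) (k : ℕ) (t : Fin T) (s : S) (a : A) (s' : S) :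
    ℝ :=
  Real.sqrt (4 * (empTrans h k t s a s' * (1 - empTrans h k t s a s')) * logFactor S A T K δ
      / max (visits h k t s a : ℝ) 1)
    + (14 * logFactor S A T K δ / 3) / max (visits h k t s a : ℝ) 1

/-- `β^p_{k,t}(s,a) = ∑_{s'} β^p_{k,t}(s,a,s')`. -/
def radiusSum (K : ℕ) (δ : ℝ) (h : ℕ → Traj S A T) (k : ℕ) (t : Fin T) (s : S) (a : A) : ℝ :=
  ∑ s' : S, radius K δ h k t s a s'

/-- Pessimistic (inflated) consumption `d̄ = d + T β^p`. -/
def pessCost (M : MDP S A T) (K : ℕ) (δ : ℝ) (h : ℕ → Traj S A T) (k : ℕ)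
    (t : Fin T) (s : S) (a : A) : ℝ :=
  M.cost t s a + (T : ℝ) * radiusSum K δ h k t s a

/-- Optimistic loss `l̄ = l - T² β^p / (b - b_base)`. -/
def optLoss (M : MDP S A T) (K : ℕ) (δ bbase b : ℝ) (h : ℕ → Traj S A T) (k : ℕ)
    (t : Fin T) (s : S) (a : A) : ℝ :=
  M.loss t s a - ((T : ℝ) ^ 2 * radiusSum K δ h k t s a) / (b - bbase)

/-- `∑_{t,s,a,s'} q_t(s,a,s') r_t(s,a)`. -/
def pairing (q : Fin T → S → A → S → ℝ) (r : Fin T → S → A → ℝ) : ℝ :=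
  ∑ t : Fin T, ∑ s : S, ∑ a : A, ∑ s' : S, q t s a s' * r t s a

/-- Feasible points of the extended linear program in the augmented occupancy measures
`q_t(s,a,s')` with budget `b`. The confidence constraint on `q_t(s,a,s') / ∑_y q_t(s,a,y)` is
in linear form, so that it is void where the denominator vanishes. -/
structure LPFeasible (M : MDP S A T) (K : ℕ) (δ b : ℝ) (h : ℕ → Traj S A T) (k : ℕ)
    (q : Fin T → S → A → S → ℝ) : Prop where
  nonneg : ∀ t s a s', 0 ≤ q t s a s'
  budget : pairing q (pessCost M K δ h k) ≤ b
  init : ∀ t : Fin T, t.val = 0 → ∀ s, ∑ a : A, ∑ s' : S, q t s a s' = M.init s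
  flow : ∀ t₀ t : Fin T, t₀.val + 1 = t.val → ∀ s,
    ∑ a : A, ∑ s' : S, q t s a s' = ∑ s'' : S, ∑ a'' : A, q t₀ s'' a'' s
  conf_lower : ∀ t s a s',
    (empTrans h k t s a s' - radius K δ h k t s a s') * ∑ y : S, q t s a y ≤ q t s a s'
  conf_upper : ∀ t s a s',
    q t s a s' ≤ (empTrans h k t s a s' + radius K δ h k t s a s') * ∑ y : S, q t s a y

/-- Optimal solutions of the extended linear program. -/
def LPOptimal (M : MDP S A T) (K : ℕ) (δ bbase b : ℝ) (h : ℕ → Traj S A T) (k : ℕ)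
    (q : Fin T → S → A → S → ℝ) : Prop :=
  LPFeasible M K δ b h k q ∧
    ∀ q', LPFeasible M K δ b h k q' →
      pairing q (optLoss M K δ bbase b h k) ≤ pairing q' (optLoss M K δ bbase b h k)

/-- `π` is obtained from `q` by normalization, wherever the denominator is nonzero. -/
def InducedBy (π : Fin T → S → A → ℝ) (q : Fin T → S → A → S → ℝ) : Prop :=
  ∀ t s, (∑ a' : A, ∑ s' : S, q t s a' s') ≠ 0 →
    ∀ a, π t s a = (∑ s' : S, q t s a s') / ∑ a' : A, ∑ s' : S, q t s a' s'

/-- A run of BALDE over the episodes `1, …, K` with `K₀` warm-up episodes, confidence level `δ`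
and safe baseline policy `πbase`, on a probability space `(Ω, ℙ)`.
* `ℋ k` is the information available at the start of episode `k`, which contains all earlier
  trajectories (and may contain anything else that is revealed earlier, such as service costs and
  dual multipliers);
* `b k` is the budget handed to the algorithm in episode `k`: any value in `[B₀, T]` that is
  determined by `ℋ k`;
* `pol k` is the policy played in episode `k`: the baseline in the warm-up phase, and afterwards
  a policy obtained from an optimal solution of the extended linear program with budget `b k`.
  If that program has no feasible point, nothing is prescribed: `pol k` may be any policy;
* `traj k` is the trajectory of episode `k`. Given `ℋ k`, it is drawn from the true model under
  the policy `pol k`. -/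
structure IsRun {Ω : Type*} {mΩ : MeasurableSpace Ω} (ℙ : Measure Ω) (M : MDP S A T)
    (πbase : Fin T → S → A → ℝ) (B₀ δ : ℝ) (K K₀ : ℕ) (ℋ : Filtration ℕ mΩ)
    (traj : ℕ → Ω → Traj S A T) (b : ℕ → Ω → ℝ) (pol : ℕ → Ω → Fin T → S → A → ℝ) : Prop where
  traj_measurable : ∀ k ∈ Finset.Icc 1 K, ∀ τ : Traj S A T,
    MeasurableSet[ℋ (k + 1)] {ω | traj k ω = τ}
  budget_measurable : ∀ k ∈ Finset.Icc 1 K, Measurable[ℋ k] (b k)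
  budget_mem : ∀ k ∈ Finset.Icc 1 K, ∀ ω, b k ω ∈ Set.Icc B₀ (T : ℝ)
  pol_measurable : ∀ k ∈ Finset.Icc 1 K, Measurable[ℋ k] (pol k)
  pol_isPolicy : ∀ k ∈ Finset.Icc 1 K, ∀ ω, IsPolicy (pol k ω)
  warmup : ∀ k ∈ Finset.Icc 1 K, k ≤ K₀ → ∀ ω, pol k ω = πbase
  solve : ∀ k ∈ Finset.Icc 1 K, K₀ < k → ∀ ω,
    (∃ q, LPFeasible M K δ (b k ω) (fun j => traj j ω) k q) →
      ∃ q, LPOptimal M K δ (M.consumption πbase) (b k ω) (fun j => traj j ω) k q ∧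
        InducedBy (pol k ω) q
  law : ∀ k ∈ Finset.Icc 1 K, ∀ τ : Traj S A T,
    ℙ[Set.indicator {ω | traj k ω = τ} (fun _ => (1 : ℝ)) | ℋ k]
      =ᵐ[ℙ] fun ω => trajProb M.init M.trans (pol k ω) τ

end Estimates

end

end BALDE

namespace BALDE

/-! Safety is deterministic on two good events. On the first, every empirical transition probability
lies within its radius of the truth; on the second, the warm-up visits each pair at least half as
often as the baseline predicts, up to `L'`.

If the confidence bounds hold, a policy induced by any feasible point `q` is safe
(`consumption_le_of_lpFeasible`). By the simulation identity `sum_init_mul_costToGo`, its true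
consumption is the consumption of `q` plus a discrepancy between the kernels of `q` and of `P`,
weighted by the cost-to-go. Both kernels lie in the same confidence interval, so the discrepancy is
at most the inflation `T β` already charged by the program.

Feasibility is witnessed by the true occupancy measure of the baseline (`lpFeasible_occupancy`). Its
inflated consumption exceeds `b_base` by `T ∑ w β`, where `w` is the visit probability. Since `β` is
of order `n^{-1/2}` and `n` is of order `K₀ w`, Cauchy–Schwarz bounds this excess by the slack `γ`
once `K₀` is of order `S²AT⁴L'²/γ²` (`inflation_le`).

Both events follow from one exponential supermartingale bound (`IsRun.measureReal_sum_ge_le`) and a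
union bound. For the transitions the union runs over the number of visits, which makes the Bernstein
exponent deterministic. Each event fails with probability at most `δ`, so the total failure
probability is at most `2δ`. -/

/-! ### Scalar inequalities behind Bernstein's bound -/

/-- The difference of the two sides vanishes with its derivative at `0` and is convex: its second
derivative is `(1 - e^u (1 - u)) / 3`, nonnegative because `1 - u ≤ e^{-u}`. -/
theorem exp_mul_one_sub_div_three_le (u : ℝ) :
    Real.exp u * (1 - u / 3) ≤ 1 + 2 * u / 3 + u ^ 2 / 6 := by
  set f : ℝ → ℝ := fun u => 1 + 2 * u / 3 + u ^ 2 / 6 - Real.exp u * (1 - u / 3) with hf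
  set f' : ℝ → ℝ := fun u => 2 / 3 + u / 3 - Real.exp u * (2 / 3 - u / 3) with hf'
  have h1 : ∀ x, HasDerivAt f (f' x) x := by
    intro x
    have := ((((hasDerivAt_id x).const_mul 2).div_const 3).const_add 1).add
      (((hasDerivAt_id x).pow 2).div_const 6) |>.sub
      ((Real.hasDerivAt_exp x).mul (((hasDerivAt_id x).div_const 3).const_sub 1))
    refine this.congr_deriv ?_
    simp only [hf', id]
    push_cast
    ring
  have h2 : ∀ x, HasDerivAt f' (1 / 3 - Real.exp x * (1 / 3 - x / 3)) x := by
    intro x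
    have := (((hasDerivAt_id x).div_const 3).const_add (2 / 3)).sub
      ((Real.hasDerivAt_exp x).mul (((hasDerivAt_id x).div_const 3).const_sub (2 / 3)))
    refine this.congr_deriv ?_
    simp only [id]
    ring
  have hmono : Monotone f' := by
    refine monotone_of_deriv_nonneg (fun x => (h2 x).differentiableAt) fun x => ?_
    rw [(h2 x).deriv]
    have h3 : 1 - x ≤ Real.exp (-x) := by linarith [Real.add_one_le_exp (-x)]
    have h4 : Real.exp x * Real.exp (-x) = 1 := by rw [← Real.exp_add]; simp
    nlinarith [Real.exp_pos x]
  have h0 : f' 0 = 0 := by simp [hf']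
  have hf0 : f 0 = 0 := by simp [hf]
  have key : 0 ≤ f u := by
    rcases le_total 0 u with hu | hu
    · have : MonotoneOn f (Set.Ici 0) := by
        refine monotoneOn_of_deriv_nonneg (convex_Ici 0)
          (fun x _ => (h1 x).continuousAt.continuousWithinAt)
          (fun x _ => (h1 x).differentiableAt.differentiableWithinAt) fun x hx => ?_
        rw [interior_Ici] at hx
        rw [(h1 x).deriv, ← h0]
        exact hmono (le_of_lt hx)
      rw [← hf0]
      exact this (by simp) hu hu
    · have : AntitoneOn f (Set.Iic 0) := by
        refine antitoneOn_of_deriv_nonpos (convex_Iic 0)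
          (fun x _ => (h1 x).continuousAt.continuousWithinAt)
          (fun x _ => (h1 x).differentiableAt.differentiableWithinAt) fun x hx => ?_
        rw [interior_Iic] at hx
        rw [(h1 x).deriv, ← h0]
        exact hmono (le_of_lt hx)
      rw [← hf0]
      exact this hu (by simp) hu
  simp only [hf] at key
  linarith

/-- The exponential of `l * x` is dominated by a quadratic in `x ≤ 1`. -/
theorem exp_mul_le_quadratic {l x : ℝ} (hl0 : 0 ≤ l) (hl : l < 3) (hx : x ≤ 1) :
    Real.exp (l * x) ≤ 1 + l * x + x ^ 2 * (l ^ 2 / (2 * (1 - l / 3))) := by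
  have hu : l * x ≤ l := by nlinarith
  have h1 : 0 < 1 - l * x / 3 := by linarith
  have h3 : 0 < 1 - l / 3 := by linarith
  have h2 : Real.exp (l * x) ≤ (1 + 2 * (l * x) / 3 + (l * x) ^ 2 / 6) / (1 - l * x / 3) := by
    rw [le_div_iff₀ h1]
    exact exp_mul_one_sub_div_three_le _
  refine h2.trans ?_
  have h4 : (1 + 2 * (l * x) / 3 + (l * x) ^ 2 / 6) / (1 - l * x / 3)
      = 1 + l * x + (l * x) ^ 2 / (2 * (1 - l * x / 3)) := by
    have h6 : 3 - l * x ≠ 0 := by linarith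
    rw [div_eq_iff h1.ne']
    field_simp
    ring
  have h5 : x ^ 2 * (l ^ 2 / (2 * (1 - l / 3))) = (l * x) ^ 2 / (2 * (1 - l / 3)) := by
    ring
  rw [h4, h5]
  gcongr

/-- Bernstein's bound for the moment generating function of a centred variable on a finite
probability space. -/
theorem sum_mul_exp_le_exp {ι : Type*} [Fintype ι] {w x : ι → ℝ} {l v : ℝ}
    (hw : w ∈ stdSimplex ℝ ι) (hx : ∀ i, x i ≤ 1) (hmean : ∑ i, w i * x i = 0)
    (hvar : ∑ i, w i * x i ^ 2 ≤ v) (hl0 : 0 ≤ l) (hl : l < 3) :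
    ∑ i, w i * Real.exp (l * x i) ≤ Real.exp (v * (l ^ 2 / (2 * (1 - l / 3)))) := by
  set c := l ^ 2 / (2 * (1 - l / 3))
  have hc : 0 ≤ c := div_nonneg (sq_nonneg _) (by linarith)
  calc ∑ i, w i * Real.exp (l * x i) ≤ ∑ i, w i * (1 + l * x i + x i ^ 2 * c) :=
        Finset.sum_le_sum fun i _ =>
          mul_le_mul_of_nonneg_left (exp_mul_le_quadratic hl0 hl (hx i)) (hw.1 i)
    _ = ∑ i, w i + l * ∑ i, w i * x i + (∑ i, w i * x i ^ 2) * c := by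
        simp only [Finset.mul_sum, Finset.sum_mul, ← Finset.sum_add_distrib]
        exact Finset.sum_congr rfl fun i _ => by ring
    _ ≤ v * c + 1 := by rw [hw.2, hmean]; nlinarith
    _ ≤ _ := Real.add_one_le_exp _

/-- From a Bernstein deviation bound with the true variance to one with the empirical
variance. -/
theorem abs_sub_le_of_sq_le {p q y : ℝ} (hp : p ∈ Set.Icc (0 : ℝ) 1) (hq : q ∈ Set.Icc (0 : ℝ) 1)
    (hy : 0 ≤ y)
    (h : |q - p| ^ 2 ≤ 2 * y * (p * (1 - p) + y / 2) + 2 / 3 * y * |q - p|) :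
    |q - p| ≤ Real.sqrt (2 * (q * (1 - q)) * y) + 3 * y := by
  set D := |q - p| with hD
  have hD0 : 0 ≤ D := abs_nonneg _
  -- The map `p ↦ p (1 - p)` is 1-Lipschitz on `[0, 1]`, so replacing the true variance by the
  -- empirical one costs only `D`.
  have hv : p * (1 - p) ≤ q * (1 - q) + D := by
    have h1 : p * (1 - p) - q * (1 - q) = (q - p) * (p + q - 1) := by ring
    have h2 : (q - p) * (p + q - 1) ≤ |q - p| * 1 := by
      refine (le_abs_self _).trans ?_
      rw [abs_mul]
      refine mul_le_mul_of_nonneg_left ?_ (abs_nonneg _)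
      rw [abs_le]
      constructor <;> linarith [hp.1, hp.2, hq.1, hq.2]
    linarith
  set s := Real.sqrt (2 * (q * (1 - q)) * y) with hs
  have hs0 : 0 ≤ s := Real.sqrt_nonneg _
  have hq' : 0 ≤ q * (1 - q) := mul_nonneg hq.1 (by linarith [hq.2])
  have hs2 : s ^ 2 = 2 * (q * (1 - q)) * y := Real.sq_sqrt (by positivity)
  have h1 : D ^ 2 ≤ s ^ 2 + y ^ 2 + 8 / 3 * y * D := by
    have := mul_le_mul_of_nonneg_left hv hy
    nlinarith
  by_contra! hlt
  nlinarith [mul_nonneg hs0 hy]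

/-- The optimal exponent in Bernstein's inequality: for the deviation `r` below, the exponent `l`
yields the rate `y`. -/
theorem exists_bernstein_exponent {v y : ℝ} (hv : 0 < v) (hy : 0 < y) :
    ∃ r l : ℝ, 0 < r ∧ 0 < l ∧ l < 3 ∧ r ^ 2 = 2 * y * v + 2 / 3 * y * r ∧
      l * r - v * (l ^ 2 / (2 * (1 - l / 3))) = y := by
  -- `y / 3 + s` is the positive root of `r² = 2 y v + (2/3) y r`.
  set s := Real.sqrt (y ^ 2 / 9 + 2 * y * v) with hs
  have hs2 : s ^ 2 = y ^ 2 / 9 + 2 * y * v := Real.sq_sqrt (by positivity)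
  have hs0 : 0 ≤ s := Real.sqrt_nonneg _
  have hr : 0 < y / 3 + s := by positivity
  have hr2 : (y / 3 + s) ^ 2 = 2 * y * v + 2 / 3 * y * (y / 3 + s) := by nlinarith
  generalize y / 3 + s = r at hr hr2
  have hd : 0 < v + r / 3 := by positivity
  refine ⟨r, r / (v + r / 3), hr, by positivity, ?_, hr2, ?_⟩
  · rw [div_lt_iff₀ hd]; linarith
  -- With this `l` the subtracted term equals `l r / 2`, so the rate is `r² / (2 (v + r / 3))`,
  -- which is `y` by the equation for `r`.
  · have h1 : 1 - r / (v + r / 3) / 3 = v / (v + r / 3) := by field_simp; ring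
    rw [h1]
    field_simp
    nlinarith

/-! ### Trajectory expectations and occupancy measures -/

section Trajectories

variable {S A : Type*}

/-- Prepend a state and an action to a trajectory. -/
def Traj.cons {T : ℕ} (s : S) (a : A) (τ : Traj S A T) : Traj S A (T + 1) :=
  (Fin.cons s τ.1, Fin.cons a τ.2)

theorem Traj.cons_state_zero {T : ℕ} (s : S) (a : A) (τ : Traj S A T) :
    (Traj.cons s a τ).state 0 = s := rfl

theorem Traj.cons_action_zero {T : ℕ} (s : S) (a : A) (τ : Traj S A T) :
    (Traj.cons s a τ).action 0 = a := rfl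

theorem Traj.cons_next_zero {T : ℕ} (s : S) (a : A) (τ : Traj S A T) :
    (Traj.cons s a τ).next 0 = τ.1 0 := rfl

theorem Traj.cons_state_succ {T : ℕ} (s : S) (a : A) (τ : Traj S A T) (t : Fin T) :
    (Traj.cons s a τ).state t.succ = τ.state t := rfl

theorem Traj.cons_action_succ {T : ℕ} (s : S) (a : A) (τ : Traj S A T) (t : Fin T) :
    (Traj.cons s a τ).action t.succ = τ.action t := rfl

theorem Traj.cons_next_succ {T : ℕ} (s : S) (a : A) (τ : Traj S A T) (t : Fin T) :
    (Traj.cons s a τ).next t.succ = τ.next t := rfl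

theorem trajProb_cons {T : ℕ} (μ : S → ℝ) (P : Fin (T + 1) → S → A → S → ℝ)
    (π : Fin (T + 1) → S → A → ℝ) (s : S) (a : A) (τ : Traj S A T) :
    trajProb μ P π (Traj.cons s a τ)
      = μ s * π 0 s a * trajProb (P 0 s a) (fun t => P t.succ) (fun t => π t.succ) τ := by
  simp only [trajProb, Fin.prod_univ_succ, Traj.cons_state_zero, Traj.cons_action_zero,
    Traj.cons_next_zero, Traj.cons_state_succ, Traj.cons_action_succ, Traj.cons_next_succ]
  have : (Traj.cons s a τ).1 0 = s := rfl
  rw [this]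
  ring

variable [Fintype S] [Fintype A] {T : ℕ}

/-- Expectation of a function of the trajectory. -/
noncomputable def trajExp (μ : S → ℝ) (P : Fin T → S → A → S → ℝ) (π : Fin T → S → A → ℝ)
    (F : Traj S A T → ℝ) : ℝ :=
  ∑ τ : Traj S A T, trajProb μ P π τ * F τ

/-- First-step decomposition: after the first pair `(s, a)`, the rest is an episode of length `T`
with initial law `P 0 s a`. The Markov properties below are inductions on it. -/
theorem trajExp_succ (μ : S → ℝ) (P : Fin (T + 1) → S → A → S → ℝ)
    (π : Fin (T + 1) → S → A → ℝ) (F : Traj S A (T + 1) → ℝ) :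
    trajExp μ P π F = ∑ s, ∑ a, μ s * π 0 s a *
      trajExp (P 0 s a) (fun t => P t.succ) (fun t => π t.succ) (fun τ => F (Traj.cons s a τ)) := by
  let e : (S × A) × Traj S A T ≃ Traj S A (T + 1) :=
    { toFun := fun x => Traj.cons x.1.1 x.1.2 x.2
      invFun := fun τ => ((τ.1 0, τ.2 0), (Fin.tail τ.1, Fin.tail τ.2))
      left_inv := fun x => rfl
      right_inv := fun τ => by
        simp [Traj.cons] }
  unfold trajExp
  rw [← e.sum_comp, Fintype.sum_prod_type, Fintype.sum_prod_type]
  refine Finset.sum_congr rfl fun s _ => Finset.sum_congr rfl fun a _ => ?_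
  rw [Finset.mul_sum]
  refine Finset.sum_congr rfl fun τ _ => ?_
  change trajProb μ P π (Traj.cons s a τ) * F (Traj.cons s a τ) = _
  rw [trajProb_cons]
  ring

theorem trajExp_add (μ : S → ℝ) (P : Fin T → S → A → S → ℝ) (π : Fin T → S → A → ℝ)
    (F G : Traj S A T → ℝ) :
    trajExp μ P π (fun τ => F τ + G τ) = trajExp μ P π F + trajExp μ P π G := by
  simp only [trajExp, mul_add, Finset.sum_add_distrib]

theorem trajExp_mul_const (μ : S → ℝ) (P : Fin T → S → A → S → ℝ) (π : Fin T → S → A → ℝ)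
    (F : Traj S A T → ℝ) (c : ℝ) :
    trajExp μ P π (fun τ => F τ * c) = trajExp μ P π F * c := by
  simp only [trajExp, Finset.sum_mul, mul_assoc]

theorem trajExp_sum {ι : Type*} (I : Finset ι) (μ : S → ℝ) (P : Fin T → S → A → S → ℝ)
    (π : Fin T → S → A → ℝ) (F : ι → Traj S A T → ℝ) :
    trajExp μ P π (fun τ => ∑ i ∈ I, F i τ) = ∑ i ∈ I, trajExp μ P π (F i) := by
  simp only [trajExp, Finset.mul_sum]
  exact Finset.sum_comm

theorem trajProb_nonneg {μ : S → ℝ} {P : Fin T → S → A → S → ℝ} {π : Fin T → S → A → ℝ}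
    (hμ : μ ∈ stdSimplex ℝ S) (hP : ∀ t s a, P t s a ∈ stdSimplex ℝ S) (hπ : IsPolicy π)
    (τ : Traj S A T) : 0 ≤ trajProb μ P π τ :=
  mul_nonneg (hμ.1 _) (Finset.prod_nonneg fun t _ => mul_nonneg ((hπ t _).1 _) ((hP t _ _).1 _))

theorem trajExp_mono {μ : S → ℝ} {P : Fin T → S → A → S → ℝ} {π : Fin T → S → A → ℝ}
    (hμ : μ ∈ stdSimplex ℝ S) (hP : ∀ t s a, P t s a ∈ stdSimplex ℝ S) (hπ : IsPolicy π)
    {F G : Traj S A T → ℝ} (h : ∀ τ, F τ ≤ G τ) : trajExp μ P π F ≤ trajExp μ P π G :=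
  Finset.sum_le_sum fun τ _ => mul_le_mul_of_nonneg_left (h τ) (trajProb_nonneg hμ hP hπ τ)

theorem trajExp_initial {μ : S → ℝ} {P : Fin T → S → A → S → ℝ} {π : Fin T → S → A → ℝ}
    (hP : ∀ t s a, P t s a ∈ stdSimplex ℝ S) (hπ : IsPolicy π) (f : S → ℝ) :
    trajExp μ P π (fun τ => f (τ.1 0)) = ∑ s, μ s * f s := by
  induction T generalizing μ f with
  | zero =>
    let e : S ≃ Traj S A 0 :=
      { toFun := fun s => (fun _ => s, Fin.elim0)
        invFun := fun τ => τ.1 0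
        left_inv := fun s => rfl
        right_inv := fun τ => by
          refine Prod.ext (funext fun i => ?_) (funext fun i => i.elim0)
          have : i = 0 := Fin.ext (by omega)
          rw [this] }
    unfold trajExp
    rw [← e.sum_comp]
    simp [e, trajProb]
  | succ T ih =>
    rw [trajExp_succ]
    refine Finset.sum_congr rfl fun s _ => ?_
    have h1 : ∀ a, trajExp (P 0 s a) (fun t => P t.succ) (fun t => π t.succ)
        (fun τ => f ((Traj.cons s a τ).1 0)) = f s := by
      intro a
      have := ih (μ := P 0 s a) (P := fun t => P t.succ) (π := fun t => π t.succ)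
        (fun t => hP t.succ) (fun t => hπ t.succ) (fun _ => f s)
      rw [← Finset.sum_mul, (hP 0 s a).2, one_mul] at this
      exact this
    simp only [h1]
    rw [← Finset.sum_mul, ← Finset.mul_sum, (hπ 0 s).2, mul_one]

theorem trajExp_const {μ : S → ℝ} {P : Fin T → S → A → S → ℝ} {π : Fin T → S → A → ℝ}
    (hμ : μ ∈ stdSimplex ℝ S) (hP : ∀ t s a, P t s a ∈ stdSimplex ℝ S) (hπ : IsPolicy π)
    (c : ℝ) : trajExp μ P π (fun _ => c) = c := by
  rw [trajExp_initial hP hπ (fun _ => c), ← Finset.sum_mul, hμ.2, one_mul]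

/-- Markov property at the next state. -/
theorem trajExp_next {μ : S → ℝ} {P : Fin T → S → A → S → ℝ} {π : Fin T → S → A → ℝ}
    (hP : ∀ t s a, P t s a ∈ stdSimplex ℝ S) (hπ : IsPolicy π)
    (t : Fin T) (g : S → A → S → ℝ) :
    trajExp μ P π (fun τ => g (τ.state t) (τ.action t) (τ.next t))
      = trajExp μ P π (fun τ => ∑ s', P t (τ.state t) (τ.action t) s'
          * g (τ.state t) (τ.action t) s') := by
  induction T generalizing μ with
  | zero => exact t.elim0
  | succ T ih =>
    rw [trajExp_succ, trajExp_succ]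
    refine Finset.sum_congr rfl fun s _ => Finset.sum_congr rfl fun a _ => ?_
    congr 1
    refine Fin.cases ?_ (fun t => ?_) t
    · simp only [Traj.cons_state_zero, Traj.cons_action_zero, Traj.cons_next_zero]
      rw [trajExp_initial (fun t => hP t.succ) (fun t => hπ t.succ) (fun s' => g s a s'),
        trajExp_const (hP 0 s a) (fun t => hP t.succ) (fun t => hπ t.succ)]
    · exact ih (fun t => hP t.succ) (fun t => hπ t.succ) t

/-- Given the current state, the action is drawn from the policy. -/
theorem trajExp_action {μ : S → ℝ} {P : Fin T → S → A → S → ℝ} {π : Fin T → S → A → ℝ}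
    (hP : ∀ t s a, P t s a ∈ stdSimplex ℝ S) (hπ : IsPolicy π)
    (t : Fin T) (g : S → A → ℝ) :
    trajExp μ P π (fun τ => g (τ.state t) (τ.action t))
      = trajExp μ P π (fun τ => ∑ a, π t (τ.state t) a * g (τ.state t) a) := by
  induction T generalizing μ with
  | zero => exact t.elim0
  | succ T ih =>
    rw [trajExp_succ, trajExp_succ]
    refine Fin.cases ?_ (fun t => ?_) t
    · refine Finset.sum_congr rfl fun s _ => ?_
      simp only [Traj.cons_state_zero, Traj.cons_action_zero]
      have h : ∀ (a : A) (c : ℝ), trajExp (P 0 s a) (fun t => P t.succ) (fun t => π t.succ)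
          (fun _ => c) = c :=
        fun a c => trajExp_const (hP 0 s a) (fun t => hP t.succ) (fun t => hπ t.succ) c
      simp only [h]
      rw [← Finset.sum_mul, ← Finset.mul_sum, (hπ 0 s).2, mul_one, Finset.mul_sum]
      exact Finset.sum_congr rfl fun a _ => by ring
    · refine Finset.sum_congr rfl fun s _ => Finset.sum_congr rfl fun a _ => ?_
      congr 1
      exact ih (fun t => hP t.succ) (fun t => hπ t.succ) t

/-- Occupancy measure of a policy in the augmented form `q_t(s, a, s')`. -/
noncomputable def occupancy [DecidableEq S] [DecidableEq A] (μ : S → ℝ)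
    (P : Fin T → S → A → S → ℝ) (π : Fin T → S → A → ℝ) (t : Fin T) (s : S) (a : A) (s' : S) : ℝ :=
  trajExp μ P π fun τ => if τ.state t = s ∧ τ.action t = a ∧ τ.next t = s' then 1 else 0

variable [DecidableEq S] [DecidableEq A]

/-- Probability of visiting the pair `(s, a)` at slot `t`. -/
noncomputable def visitProb (μ : S → ℝ)
    (P : Fin T → S → A → S → ℝ) (π : Fin T → S → A → ℝ) (t : Fin T) (s : S) (a : A) : ℝ :=
  trajExp μ P π fun τ => if τ.state t = s ∧ τ.action t = a then 1 else 0

theorem sum_occupancy_next (μ : S → ℝ) (P : Fin T → S → A → S → ℝ) (π : Fin T → S → A → ℝ)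
    (t : Fin T) (s : S) (a : A) :
    ∑ s', occupancy μ P π t s a s' = visitProb μ P π t s a := by
  unfold occupancy visitProb
  rw [← trajExp_sum]
  congr 1
  funext τ
  by_cases h : τ.state t = s <;> by_cases h' : τ.action t = a <;> simp [h, h']

theorem sum_visitProb (μ : S → ℝ) (P : Fin T → S → A → S → ℝ) (π : Fin T → S → A → ℝ)
    (t : Fin T) (s : S) :
    ∑ a, visitProb μ P π t s a = trajExp μ P π fun τ => if τ.state t = s then 1 else 0 := by
  unfold visitProb
  rw [← trajExp_sum]
  congr 1
  funext τ
  by_cases h : τ.state t = s <;> simp [h]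

section

variable {μ : S → ℝ} {P : Fin T → S → A → S → ℝ} {π : Fin T → S → A → ℝ}

theorem visitProb_nonneg (hμ : μ ∈ stdSimplex ℝ S) (hP : ∀ t s a, P t s a ∈ stdSimplex ℝ S)
    (hπ : IsPolicy π) (t : Fin T) (s : S) (a : A) : 0 ≤ visitProb μ P π t s a :=
  Finset.sum_nonneg fun τ _ => mul_nonneg (trajProb_nonneg hμ hP hπ τ) (by dsimp only; split_ifs <;> simp)

theorem sum_sum_visitProb (hμ : μ ∈ stdSimplex ℝ S) (hP : ∀ t s a, P t s a ∈ stdSimplex ℝ S)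
    (hπ : IsPolicy π) (t : Fin T) : ∑ s, ∑ a, visitProb μ P π t s a = 1 := by
  simp only [sum_visitProb]
  rw [← trajExp_sum]
  simp only [Finset.sum_ite_eq, Finset.mem_univ, if_true]
  exact trajExp_const hμ hP hπ 1

theorem occupancy_nonneg (hμ : μ ∈ stdSimplex ℝ S) (hP : ∀ t s a, P t s a ∈ stdSimplex ℝ S)
    (hπ : IsPolicy π) (t : Fin T) (s : S) (a : A) (s' : S) : 0 ≤ occupancy μ P π t s a s' :=
  Finset.sum_nonneg fun τ _ => mul_nonneg (trajProb_nonneg hμ hP hπ τ) (by dsimp only; split_ifs <;> simp)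

theorem occupancy_eq (hP : ∀ t s a, P t s a ∈ stdSimplex ℝ S) (hπ : IsPolicy π)
    (t : Fin T) (s : S) (a : A) (s' : S) :
    occupancy μ P π t s a s' = visitProb μ P π t s a * P t s a s' := by
  unfold occupancy visitProb
  rw [trajExp_next hP hπ t (fun x u x' => if x = s ∧ u = a ∧ x' = s' then 1 else 0),
    ← trajExp_mul_const]
  congr 1
  funext τ
  by_cases h : τ.state t = s <;> by_cases h' : τ.action t = a <;> simp [h, h']

theorem visitProb_eq (hP : ∀ t s a, P t s a ∈ stdSimplex ℝ S) (hπ : IsPolicy π)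
    (t : Fin T) (s : S) (a : A) :
    visitProb μ P π t s a = π t s a * ∑ a', visitProb μ P π t s a' := by
  rw [sum_visitProb, mul_comm, ← trajExp_mul_const]
  unfold visitProb
  rw [trajExp_action hP hπ t (fun x u => if x = s ∧ u = a then 1 else 0)]
  congr 1
  funext τ
  by_cases h : τ.state t = s <;> simp [h]

theorem sum_occupancy_init (hP : ∀ t s a, P t s a ∈ stdSimplex ℝ S) (hπ : IsPolicy π)
    (t : Fin T) (ht : t.val = 0) (s : S) :
    ∑ a, ∑ s', occupancy μ P π t s a s' = μ s := by
  simp only [sum_occupancy_next, sum_visitProb]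
  have h0 : t.castSucc = 0 := Fin.ext ht
  have := trajExp_initial (μ := μ) hP hπ (fun x => if x = s then (1 : ℝ) else 0)
  simpa [Traj.state, h0] using this

/-- Holds trajectory by trajectory, since the state following slot `t₀` is the state at slot `t`. -/
theorem sum_occupancy_flow (t₀ t : Fin T) (ht : t₀.val + 1 = t.val) (s : S) :
    ∑ a, ∑ s', occupancy μ P π t s a s' = ∑ s'', ∑ a'', occupancy μ P π t₀ s'' a'' s := by
  simp only [sum_occupancy_next, sum_visitProb]
  simp only [occupancy, ← trajExp_sum]
  have h0 : t₀.succ = t.castSucc := Fin.ext ht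
  congr 1
  funext τ
  have h1 : τ.next t₀ = τ.state t := by simp [Traj.next, Traj.state, h0]
  rw [h1]
  by_cases h : τ.state t = s
  · simp [h, ite_and]
  · simp [h]

theorem value_eq_sum_visitProb (r : Fin T → S → A → ℝ) :
    value μ P r π = ∑ t, ∑ s, ∑ a, visitProb μ P π t s a * r t s a := by
  have h : value μ P r π = trajExp μ P π fun τ => ∑ t, r t (τ.state t) (τ.action t) := rfl
  rw [h, trajExp_sum]
  refine Finset.sum_congr rfl fun t _ => ?_
  simp only [visitProb, ← trajExp_mul_const, ← trajExp_sum]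
  congr 1
  funext τ
  simp [ite_and]

theorem pairing_occupancy (r : Fin T → S → A → ℝ) :
    pairing (occupancy μ P π) r = ∑ t, ∑ s, ∑ a, visitProb μ P π t s a * r t s a := by
  unfold pairing
  simp only [← Finset.sum_mul, sum_occupancy_next]

end

end Trajectories

/-! ### Cost-to-go and the simulation identity -/

section CostToGo

variable {S A : Type*} [Fintype S] [Fintype A] {T : ℕ}

/-- Expected reward from slot `t` on, under kernels `P` and policy `π`. -/
noncomputable def costToGo (P : Fin T → S → A → S → ℝ) (r : Fin T → S → A → ℝ)
    (π : Fin T → S → A → ℝ) (t : ℕ) (s : S) : ℝ :=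
  if h : t < T then
    ∑ a, π ⟨t, h⟩ s a * (r ⟨t, h⟩ s a + ∑ s', P ⟨t, h⟩ s a s' * costToGo P r π (t + 1) s')
  else 0
termination_by T - t

variable {P : Fin T → S → A → S → ℝ} {r : Fin T → S → A → ℝ} {π : Fin T → S → A → ℝ}

theorem costToGo_fin (t : Fin T) (s : S) : costToGo P r π t s
    = ∑ a, π t s a * (r t s a + ∑ s', P t s a s' * costToGo P r π (t + 1) s') := by
  rw [costToGo, dif_pos t.2]

theorem costToGo_of_le {t : ℕ} (h : T ≤ t) (s : S) : costToGo P r π t s = 0 := by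
  rw [costToGo, dif_neg (by omega)]

theorem costToGo_mem_Icc (hP : ∀ t s a, P t s a ∈ stdSimplex ℝ S)
    (hr : ∀ t s a, r t s a ∈ Set.Icc (0 : ℝ) 1) (hπ : IsPolicy π) (t : ℕ) (s : S) :
    costToGo P r π t s ∈ Set.Icc (0 : ℝ) ((T - t : ℕ) : ℝ) := by
  by_cases ht : t < T
  · have hsub : ((T - t : ℕ) : ℝ) = 1 + ((T - (t + 1) : ℕ) : ℝ) := by
      have : T - t = 1 + (T - (t + 1)) := by omega
      rw [this]; push_cast; rfl
    have ih := costToGo_mem_Icc hP hr hπ (t + 1)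
    rw [costToGo_fin ⟨t, ht⟩, hsub]
    generalize ((T - (t + 1) : ℕ) : ℝ) = c at ih
    have hin : ∀ a, r ⟨t, ht⟩ s a + ∑ s', P ⟨t, ht⟩ s a s' * costToGo P r π (t + 1) s'
        ∈ Set.Icc (0 : ℝ) (1 + c) := by
      intro a
      constructor
      · exact add_nonneg (hr _ _ _).1
          (Finset.sum_nonneg fun s' _ => mul_nonneg ((hP _ _ _).1 _) (ih s').1)
      · refine add_le_add (hr _ _ _).2 ?_
        calc _ ≤ ∑ s', P ⟨t, ht⟩ s a s' * c :=
              Finset.sum_le_sum fun s' _ => mul_le_mul_of_nonneg_left (ih s').2 ((hP _ _ _).1 _)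
          _ = c := by rw [← Finset.sum_mul, (hP _ _ _).2, one_mul]
    constructor
    · exact Finset.sum_nonneg fun a _ => mul_nonneg ((hπ _ _).1 _) (hin a).1
    · calc _ ≤ ∑ a, π ⟨t, ht⟩ s a * (1 + c) :=
            Finset.sum_le_sum fun a _ => mul_le_mul_of_nonneg_left (hin a).2 ((hπ _ _).1 _)
        _ = 1 + c := by rw [← Finset.sum_mul, (hπ _ _).2, one_mul]
  · rw [costToGo_of_le (by omega)]
    simp
termination_by T - t

/-- Simulation identity: the value from the initial law equals the reward collected by a flow `q`
plus a term for the discrepancy between `P` and the kernels of `q`. -/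
theorem sum_init_mul_costToGo {μ : S → ℝ} {q : Fin T → S → A → S → ℝ}
    (hinit : ∀ t : Fin T, t.val = 0 → ∀ s, ∑ a, ∑ s', q t s a s' = μ s)
    (hflow : ∀ t₀ t : Fin T, t₀.val + 1 = t.val → ∀ s,
      ∑ a, ∑ s', q t s a s' = ∑ s'', ∑ a'', q t₀ s'' a'' s)
    (hπ : ∀ t s a, ∑ s', q t s a s' = π t s a * ∑ a', ∑ s', q t s a' s') :
    ∑ s, μ s * costToGo P r π 0 s = pairing q r + ∑ t : Fin T, ∑ s, ∑ a, ∑ s',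
      ((∑ y, q t s a y) * P t s a s' - q t s a s') * costToGo P r π (t + 1) s' := by
  rcases Nat.eq_zero_or_pos T with rfl | hT
  · simp [pairing, costToGo_of_le]
  set V := costToGo P r π with hV
  -- `f n` is the cost-to-go averaged over the state marginal of `q` at slot `n`. It vanishes at
  -- `T`, so its decrements telescope to `f 0`.
  let f : ℕ → ℝ := fun n =>
    if h : n < T then ∑ s, (∑ a, ∑ s', q ⟨n, h⟩ s a s') * V n s else 0
  have hf0 : f 0 = ∑ s, μ s * V 0 s := by
    simp only [f, dif_pos hT]
    exact Finset.sum_congr rfl fun s _ => by rw [hinit ⟨0, hT⟩ rfl]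
  have hfT : f T = 0 := by simp [f]
  have htel : ∑ t : Fin T, (f t - f (t + 1)) = f 0 := by
    rw [Fin.sum_univ_eq_sum_range (fun n => f n - f (n + 1)), Finset.sum_range_sub', hfT, sub_zero]
  rw [← hf0, ← htel, pairing, ← Finset.sum_add_distrib]
  refine Finset.sum_congr rfl fun t _ => ?_
  have h1 : f t = ∑ s, ∑ a, (∑ y, q t s a y) * (r t s a + ∑ s', P t s a s' * V (t + 1) s') := by
    simp only [f, dif_pos t.2]
    refine Finset.sum_congr rfl fun s _ => ?_
    rw [hV, costToGo_fin t s, Finset.mul_sum]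
    refine Finset.sum_congr rfl fun a _ => ?_
    rw [hπ t s a]
    ring
  have h2 : f (t + 1) = ∑ s, ∑ a, ∑ s', q t s a s' * V (t + 1) s' := by
    have h3 : f (t + 1) = ∑ s', (∑ s, ∑ a, q t s a s') * V (t + 1) s' := by
      -- At the last slot no flow constraint is available, but the cost-to-go after it is zero.
      by_cases h : t.val + 1 < T
      · simp only [f, dif_pos h]
        exact Finset.sum_congr rfl fun s _ => by rw [hflow t ⟨t + 1, h⟩ rfl]
      · simp only [f, dif_neg h]
        symm
        exact Finset.sum_eq_zero fun s _ => by rw [hV, costToGo_of_le (by omega), mul_zero]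
    rw [h3]
    simp only [Finset.sum_mul]
    rw [Finset.sum_comm]
    exact Finset.sum_congr rfl fun s _ => Finset.sum_comm
  rw [h1, h2]
  simp only [← Finset.sum_sub_distrib, ← Finset.sum_add_distrib]
  refine Finset.sum_congr rfl fun s _ => Finset.sum_congr rfl fun a _ => ?_
  simp only [mul_add, sub_mul, Finset.sum_add_distrib, Finset.sum_sub_distrib, Finset.sum_mul,
    Finset.mul_sum]
  have : ∀ i j, q t s a i * (P t s a j * V (t + 1) j) = q t s a i * P t s a j * V (t + 1) j :=
    fun i j => by ring
  simp only [this]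
  ring

/-- The simulation identity applied to the policy's own occupancy measure: its kernels are `P`, so
the discrepancy term vanishes. -/
theorem value_eq_sum_costToGo [DecidableEq S] [DecidableEq A] {μ : S → ℝ}
    (hP : ∀ t s a, P t s a ∈ stdSimplex ℝ S) (hπ : IsPolicy π) :
    value μ P r π = ∑ s, μ s * costToGo P r π 0 s := by
  rw [sum_init_mul_costToGo (q := occupancy μ P π) (sum_occupancy_init hP hπ)
    (sum_occupancy_flow), value_eq_sum_visitProb, pairing_occupancy]
  · simp only [sum_occupancy_next]
    simp [occupancy_eq hP hπ]
  · intro t s a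
    simp only [sum_occupancy_next]
    exact visitProb_eq hP hπ t s a

end CostToGo

/-! ### Size of the confidence radii -/

section Confidence

theorem sum_sqrt_le {ι : Type*} (I : Finset ι) {x : ι → ℝ} (hx : ∀ i ∈ I, 0 ≤ x i) :
    ∑ i ∈ I, Real.sqrt (x i) ≤ Real.sqrt (I.card * ∑ i ∈ I, x i) := by
  refine Real.le_sqrt_of_sq_le ?_
  refine (sq_sum_le_card_mul_sum_sq).trans (le_of_eq ?_)
  congr 1
  exact Finset.sum_congr rfl fun i hi => Real.sq_sqrt (hx i hi)

variable {S A : Type*} [DecidableEq S] [DecidableEq A] {T : ℕ}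

theorem visits_mono (h : ℕ → Traj S A T) {k m : ℕ} (hkm : k ≤ m) (t : Fin T) (s : S) (a : A) :
    visits h k t s a ≤ visits h m t s a :=
  Finset.card_le_card (Finset.filter_subset_filter _ (Finset.Ico_subset_Ico_right hkm))

theorem empTrans_nonneg (h : ℕ → Traj S A T) (k : ℕ) (t : Fin T) (s : S) (a : A) (s' : S) :
    0 ≤ empTrans h k t s a s' := by
  unfold empTrans; positivity

variable [Fintype S]

theorem sum_visitsNext (h : ℕ → Traj S A T) (k : ℕ) (t : Fin T) (s : S) (a : A) :
    ∑ s', visitsNext h k t s a s' = visits h k t s a := by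
  simp only [visitsNext, visits, Finset.card_filter]
  rw [Finset.sum_comm]
  refine Finset.sum_congr rfl fun j _ => ?_
  by_cases h1 : (h j).state t = s <;> by_cases h2 : (h j).action t = a <;> simp [h1, h2]

theorem sum_empTrans_le_one (h : ℕ → Traj S A T) (k : ℕ) (t : Fin T) (s : S) (a : A) :
    ∑ s', empTrans h k t s a s' ≤ 1 := by
  unfold empTrans
  rw [← Finset.sum_div, ← Nat.cast_sum, sum_visitsNext]
  exact div_le_one_of_le₀ (le_max_left _ _) (by positivity)

theorem empTrans_le_one (h : ℕ → Traj S A T) (k : ℕ) (t : Fin T) (s : S) (a : A) (s' : S) :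
    empTrans h k t s a s' ≤ 1 :=
  (Finset.single_le_sum (f := fun s' => empTrans h k t s a s')
    (fun i _ => empTrans_nonneg h k t s a i) (Finset.mem_univ s')).trans
    (sum_empTrans_le_one h k t s a)

variable [Fintype A]

/-- Dropping the factor `1 - p̂` and applying Cauchy–Schwarz over the next states, where the `p̂`
sum to at most one, gives `√S` instead of `S` in the leading term. -/
theorem radiusSum_le {K : ℕ} {δ : ℝ} (hL : 0 ≤ logFactor S A T K δ) (h : ℕ → Traj S A T) (k : ℕ)
    (t : Fin T) (s : S) (a : A) :
    radiusSum K δ h k t s a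
      ≤ 2 * Real.sqrt (Fintype.card S * logFactor S A T K δ / max (visits h k t s a : ℝ) 1)
        + 14 / 3 * (Fintype.card S * logFactor S A T K δ / max (visits h k t s a : ℝ) 1) := by
  unfold radiusSum radius
  set L := logFactor S A T K δ
  set n := max (visits h k t s a : ℝ) 1
  have hn : 0 < n := by positivity
  rw [Finset.sum_add_distrib]
  refine add_le_add ?_ (le_of_eq ?_)
  · have h0 := empTrans_nonneg h k t s a
    calc _ ≤ ∑ s', Real.sqrt (empTrans h k t s a s' * (4 * L / n)) := by
          refine Finset.sum_le_sum fun s' _ => Real.sqrt_le_sqrt ?_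
          rw [mul_div_assoc', mul_comm _ (4 * L), mul_right_comm]
          gcongr
          nlinarith [h0 s']
      _ ≤ Real.sqrt (Fintype.card S * ∑ s', empTrans h k t s a s' * (4 * L / n)) :=
          sum_sqrt_le _ fun s' _ => mul_nonneg (h0 s') (by positivity)
      _ ≤ Real.sqrt (2 ^ 2 * (Fintype.card S * L / n)) := by
          refine Real.sqrt_le_sqrt ?_
          rw [← Finset.sum_mul]
          calc _ ≤ (Fintype.card S : ℝ) * (1 * (4 * L / n)) := by
                gcongr
                exact sum_empTrans_le_one h k t s a
            _ = _ := by ring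
      _ = _ := by rw [Real.sqrt_mul (by norm_num), Real.sqrt_sq (by norm_num)]
  · rw [Finset.sum_const, Finset.card_univ, nsmul_eq_mul]
    ring

/-- Trades the random count for the visit probability `w`. Rarely visited pairs have a large radius
but a small weight: the product involves only `w / n`, of order `L / N`. -/
theorem mul_radiusSum_le {K : ℕ} {δ : ℝ} (hL : 1 / 2 ≤ logFactor S A T K δ)
    (h : ℕ → Traj S A T) (k : ℕ) (t : Fin T) (s : S) (a : A) {N w : ℝ} (hN : 0 < N) (hw : 0 ≤ w)
    (hv : N * w / 2 - logFactor S A T K δ ≤ visits h k t s a) :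
    w * radiusSum K δ h k t s a
      ≤ 5 * logFactor S A T K δ * Real.sqrt (Fintype.card S * w / N)
        + 28 * (Fintype.card S * logFactor S A T K δ ^ 2 / N) := by
  have hrad := mul_le_mul_of_nonneg_left
    (radiusSum_le (by linarith : 0 ≤ logFactor S A T K δ) h k t s a) hw
  refine hrad.trans ?_
  set L := logFactor S A T K δ
  have hn1 : 1 ≤ max (visits h k t s a : ℝ) 1 := le_max_right _ _
  have hn2 : (visits h k t s a : ℝ) ≤ max (visits h k t s a : ℝ) 1 := le_max_left _ _
  generalize max (visits h k t s a : ℝ) 1 = n at hn1 hn2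
  have hn : 0 < n := by linarith
  -- `N w ≤ 2 n + 2 L`, while `1 ≤ n` and `1 ≤ 2 L` give `2 n ≤ 4 L n` and `2 L ≤ 2 L n`.
  have h1 : N * w ≤ 6 * L * n := by nlinarith
  have h2 : w / n ≤ 6 * L / N := by
    rw [div_le_div_iff₀ hn hN]; linarith
  rw [mul_add]
  refine add_le_add ?_ ?_
  · calc w * (2 * Real.sqrt (Fintype.card S * L / n))
        = 2 * Real.sqrt (w ^ 2 * (Fintype.card S * L / n)) := by
          rw [Real.sqrt_mul (sq_nonneg w), Real.sqrt_sq hw]; ring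
      _ = 2 * Real.sqrt (Fintype.card S * L * w * (w / n)) := by
          congr 2; ring
      _ ≤ 2 * Real.sqrt (Fintype.card S * L * w * (6 * L / N)) := by
          have hL0 : 0 ≤ L := by linarith
          have : 0 ≤ (Fintype.card S : ℝ) * L * w := by positivity
          gcongr
      _ = Real.sqrt (24 * L ^ 2 * (Fintype.card S * w / N)) := by
          rw [show (24 : ℝ) * L ^ 2 * (Fintype.card S * w / N)
            = 2 ^ 2 * (Fintype.card S * L * w * (6 * L / N)) by ring,
            Real.sqrt_mul (x := 2 ^ 2) (by norm_num), Real.sqrt_sq (by norm_num)]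
      _ ≤ Real.sqrt ((5 * L) ^ 2 * (Fintype.card S * w / N)) := by
          refine Real.sqrt_le_sqrt (mul_le_mul_of_nonneg_right ?_ (by positivity))
          nlinarith
      _ = _ := by rw [Real.sqrt_mul (by positivity), Real.sqrt_sq (by linarith)]
  · calc w * (14 / 3 * (Fintype.card S * L / n)) = 14 / 3 * Fintype.card S * L * (w / n) := by ring
      _ ≤ 14 / 3 * Fintype.card S * L * (6 * L / N) := by gcongr
      _ = _ := by ring

/-- Cauchy–Schwarz over the `S A` pairs, with total weight one. -/
theorem sum_mul_radiusSum_le {K : ℕ} {δ : ℝ} (hL : 1 / 2 ≤ logFactor S A T K δ)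
    (h : ℕ → Traj S A T) (k : ℕ) (t : Fin T) {N : ℝ} (hN : 0 < N) {w : S → A → ℝ}
    (hw : ∀ s a, 0 ≤ w s a) (hw1 : ∑ s, ∑ a, w s a = 1)
    (hv : ∀ s a, N * w s a / 2 - logFactor S A T K δ ≤ visits h k t s a) :
    ∑ s, ∑ a, w s a * radiusSum K δ h k t s a
      ≤ 5 * Real.sqrt ((Fintype.card S : ℝ) ^ 2 * Fintype.card A * logFactor S A T K δ ^ 2 / N)
        + 28 * ((Fintype.card S : ℝ) ^ 2 * Fintype.card A * logFactor S A T K δ ^ 2 / N) := by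
  set L := logFactor S A T K δ with hLdef
  calc _ ≤ ∑ s, ∑ a, (5 * L * Real.sqrt (Fintype.card S * w s a / N)
        + 28 * (Fintype.card S * L ^ 2 / N)) :=
        Finset.sum_le_sum fun s _ => Finset.sum_le_sum fun a _ =>
          mul_radiusSum_le hL h k t s a hN (hw s a) (hv s a)
    _ = 5 * L * ∑ x : S × A, Real.sqrt (Fintype.card S * w x.1 x.2 / N)
        + 28 * ((Fintype.card S : ℝ) ^ 2 * Fintype.card A * L ^ 2 / N) := by
        simp only [Finset.sum_add_distrib, ← Finset.mul_sum, Fintype.sum_prod_type]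
        simp only [Finset.sum_const, Finset.card_univ, nsmul_eq_mul]
        ring
    _ ≤ _ := by
        refine add_le_add ?_ le_rfl
        rw [mul_assoc]
        refine mul_le_mul_of_nonneg_left ?_ (by norm_num)
        have h1 := sum_sqrt_le (Finset.univ : Finset (S × A))
          (x := fun x => Fintype.card S * w x.1 x.2 / N)
          (fun x _ => div_nonneg (mul_nonneg (by positivity) (hw _ _)) hN.le)
        refine (mul_le_mul_of_nonneg_left h1 (by linarith)).trans (le_of_eq ?_)
        rw [← Finset.sum_div, ← Finset.mul_sum, Fintype.sum_prod_type, hw1, Finset.card_univ,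
          Fintype.card_prod]
        rw [← Real.sqrt_sq (by linarith : 0 ≤ L), ← Real.sqrt_mul (sq_nonneg L),
          Real.sqrt_sq (by linarith : 0 ≤ L)]
        congr 1
        push_cast
        ring

end Confidence

/-! ### Feasibility of the baseline and safety of feasible points -/

section Safety

variable {S A : Type*} [Fintype S] [Fintype A] [DecidableEq S] [DecidableEq A] {T : ℕ}

/-- The occupancy measure of a policy is feasible as soon as the confidence intervals hold and the
inflation of its consumption fits into the budget. -/
theorem lpFeasible_occupancy (M : MDP S A T) {K : ℕ} {δ b : ℝ} {h : ℕ → Traj S A T} {k : ℕ}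
    {π : Fin T → S → A → ℝ} (hπ : IsPolicy π)
    (hconf : ∀ t s a s', |empTrans h k t s a s' - M.trans t s a s'| ≤ radius K δ h k t s a s')
    (hb : M.consumption π + T * ∑ t, ∑ s, ∑ a,
      visitProb M.init M.trans π t s a * radiusSum K δ h k t s a ≤ b) :
    LPFeasible M K δ b h k (occupancy M.init M.trans π) where
  nonneg := occupancy_nonneg M.init_mem M.trans_mem hπ
  budget := by
    rw [pairing_occupancy]
    refine le_trans (le_of_eq ?_) hb
    rw [MDP.consumption, value_eq_sum_visitProb]
    simp only [pessCost, Finset.mul_sum, ← Finset.sum_add_distrib]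
    refine Finset.sum_congr rfl fun t _ => Finset.sum_congr rfl fun s _ =>
      Finset.sum_congr rfl fun a _ => by ring
  init := sum_occupancy_init M.trans_mem hπ
  flow := sum_occupancy_flow
  conf_lower t s a s' := by
    rw [sum_occupancy_next, occupancy_eq M.trans_mem hπ, mul_comm (visitProb _ _ _ _ _ _)]
    refine mul_le_mul_of_nonneg_right ?_ (visitProb_nonneg M.init_mem M.trans_mem hπ t s a)
    have := abs_le.1 (hconf t s a s')
    linarith
  conf_upper t s a s' := by
    rw [sum_occupancy_next, occupancy_eq M.trans_mem hπ, mul_comm (visitProb _ _ _ _ _ _)]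
    refine mul_le_mul_of_nonneg_right ?_ (visitProb_nonneg M.init_mem M.trans_mem hπ t s a)
    have := abs_le.1 (hconf t s a s')
    linarith

/-- A policy induced by a feasible point respects the budget under the true kernels. -/
theorem consumption_le_of_lpFeasible (M : MDP S A T) {K : ℕ} {δ b : ℝ} {h : ℕ → Traj S A T} {k : ℕ}
    {π : Fin T → S → A → ℝ} (hπ : IsPolicy π)
    (hconf : ∀ t s a s', |empTrans h k t s a s' - M.trans t s a s'| ≤ radius K δ h k t s a s')
    {q : Fin T → S → A → S → ℝ} (hq : LPFeasible M K δ b h k q) (hind : InducedBy π q) :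
    M.consumption π ≤ b := by
  have hpol : ∀ t s a, ∑ s', q t s a s' = π t s a * ∑ a', ∑ s', q t s a' s' := by
    intro t s a
    -- At states without mass normalization prescribes nothing, but nonnegativity makes every `q t s
    -- a s'` there zero.
    by_cases h0 : ∑ a', ∑ s', q t s a' s' = 0
    · rw [h0, mul_zero]
      exact (Finset.sum_eq_zero_iff_of_nonneg
        (fun a _ => Finset.sum_nonneg fun s' _ => hq.nonneg t s a s')).1 h0 a (Finset.mem_univ a)
    · rw [hind t s h0 a, div_mul_cancel₀ _ h0]
  refine le_trans ?_ hq.budget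
  rw [MDP.consumption, value_eq_sum_costToGo M.trans_mem hπ,
    sum_init_mul_costToGo hq.init hq.flow hpol]
  have hsplit : pairing q (pessCost M K δ h k) = pairing q M.cost
      + ∑ t, ∑ s, ∑ a, (∑ y, q t s a y) * (T * radiusSum K δ h k t s a) := by
    simp only [pairing, pessCost, Finset.sum_mul, ← Finset.sum_add_distrib, mul_add]
  rw [hsplit]
  refine add_le_add le_rfl (Finset.sum_le_sum fun t _ => Finset.sum_le_sum fun s _ =>
    Finset.sum_le_sum fun a _ => ?_)
  set V := costToGo M.trans M.cost π
  set Q := ∑ y, q t s a y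
  have hQ : 0 ≤ Q := Finset.sum_nonneg fun y _ => hq.nonneg t s a y
  -- Zero total discrepancy allows centring the cost-to-go at `T / 2`. This halves its range and
  -- cancels the `2` from comparing two kernels within `β` of the same estimate, leaving exactly `T
  -- β`.
  have hzero : ∑ s', (Q * M.trans t s a s' - q t s a s') = 0 := by
    rw [Finset.sum_sub_distrib, ← Finset.mul_sum, (M.trans_mem t s a).2, mul_one, sub_self]
  calc ∑ s', (Q * M.trans t s a s' - q t s a s') * V (t + 1) s'
      = ∑ s', (Q * M.trans t s a s' - q t s a s') * (V (t + 1) s' - T / 2) := by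
        simp only [mul_sub, Finset.sum_sub_distrib]
        rw [← Finset.sum_mul, hzero, zero_mul, sub_zero]
    _ ≤ ∑ s', 2 * (Q * radius K δ h k t s a s') * (T / 2) := by
        refine Finset.sum_le_sum fun s' _ => (le_abs_self _).trans ?_
        rw [abs_mul]
        have h1 := abs_le.1 (hconf t s a s')
        have h2 := hq.conf_lower t s a s'
        have h3 := hq.conf_upper t s a s'
        refine mul_le_mul ?_ ?_ (abs_nonneg _) ?_
        · have h4 := mul_le_mul_of_nonneg_right h1.1 hQ
          have h5 := mul_le_mul_of_nonneg_right h1.2 hQ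
          rw [abs_le]
          constructor <;> linarith
        · have h4 := costToGo_mem_Icc M.trans_mem M.cost_mem hπ (t + 1) s'
          have h5 : ((T - (t + 1) : ℕ) : ℝ) ≤ T := by
            exact_mod_cast Nat.sub_le _ _
          rw [abs_le]
          constructor <;> linarith [h4.1, h4.2]
        · have h4 : 0 ≤ radius K δ h k t s a s' := (abs_nonneg _).trans (hconf t s a s')
          positivity
    _ = Q * (T * radiusSum K δ h k t s a) := by
        rw [radiusSum, Finset.mul_sum, Finset.mul_sum]
        exact Finset.sum_congr rfl fun s' _ => by ring

/-- Enough visits of the baseline keep the inflation of its consumption below the slack `g`. -/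
theorem inflation_le {M : MDP S A T} {K : ℕ} {δ g N : ℝ} {h : ℕ → Traj S A T} {k : ℕ}
    {π : Fin T → S → A → ℝ} (hπ : IsPolicy π) (hT : 0 < T)
    (hL : 1 / 2 ≤ logFactor S A T K δ) (hg : 0 < g) (hgT : g ≤ T) (hN : 0 < N)
    (hwarm : 100 * ((Fintype.card S : ℝ) ^ 2 * (Fintype.card A : ℝ) * (T : ℝ) ^ 4 / g ^ 2)
      * logFactor S A T K δ ^ 2 ≤ N)
    (hv : ∀ t s a, N * visitProb M.init M.trans π t s a / 2 - logFactor S A T K δ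
      ≤ visits h k t s a) :
    T * ∑ t, ∑ s, ∑ a, visitProb M.init M.trans π t s a * radiusSum K δ h k t s a ≤ g := by
  have hT1 : (1 : ℝ) ≤ T := by exact_mod_cast hT
  set R := (Fintype.card S : ℝ) ^ 2 * Fintype.card A * logFactor S A T K δ ^ 2 / N with hR
  have hsum : ∑ t, ∑ s, ∑ a, visitProb M.init M.trans π t s a * radiusSum K δ h k t s a
      ≤ ∑ _t : Fin T, (5 * Real.sqrt R + 28 * R) :=
    Finset.sum_le_sum fun t _ => sum_mul_radiusSum_le hL h k t hN
      (visitProb_nonneg M.init_mem M.trans_mem hπ t)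
      (sum_sum_visitProb M.init_mem M.trans_mem hπ t) (hv t)
  rw [Finset.sum_const, Finset.card_univ, Fintype.card_fin, nsmul_eq_mul] at hsum
  -- The constant `100` of the warm-up condition is chosen here: the square-root term then
  -- contributes `g / 2`, and the linear term at most `28 g / 100` since `g ≤ T ≤ T²`.
  have hRle : R ≤ (g / (10 * T ^ 2)) ^ 2 := by
    rw [hR, div_le_iff₀ hN]
    calc _ = (g / (10 * T ^ 2)) ^ 2 * (100 * ((Fintype.card S : ℝ) ^ 2 * (Fintype.card A : ℝ)
          * (T : ℝ) ^ 4 / g ^ 2) * logFactor S A T K δ ^ 2) := by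
          field_simp
          ring
      _ ≤ _ := by gcongr
  have hsqrt : Real.sqrt R ≤ g / (10 * T ^ 2) :=
    Real.sqrt_le_iff.2 ⟨by positivity, hRle⟩
  calc _ ≤ (T : ℝ) * (T * (5 * (g / (10 * T ^ 2)) + 28 * (g / (10 * T ^ 2)) ^ 2)) := by
        refine (mul_le_mul_of_nonneg_left hsum (by positivity)).trans ?_
        gcongr
    _ = g / 2 + 28 / 100 * g * (g / T ^ 2) := by
        field_simp
        ring
    _ ≤ g / 2 + 28 / 100 * g * 1 := by
        have : g / (T : ℝ) ^ 2 ≤ 1 := by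
          rw [div_le_one (by positivity)]
          nlinarith
        gcongr
    _ ≤ g := by linarith

end Safety

/-! ### Stopping sums at a given number of visits -/

section Counting

variable {S A : Type*} [DecidableEq S] [DecidableEq A] {T : ℕ}

theorem visits_eq_sum (h : ℕ → Traj S A T) (k : ℕ) (t : Fin T) (s : S) (a : A) :
    visits h k t s a
      = ∑ j ∈ Finset.Ico 1 k, if (h j).state t = s ∧ (h j).action t = a then 1 else 0 :=
  Finset.card_filter _ _

theorem visitsNext_le_visits (h : ℕ → Traj S A T) (k : ℕ) (t : Fin T) (s : S) (a : A) (s' : S) :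
    visitsNext h k t s a s' ≤ visits h k t s a :=
  Finset.card_le_card fun _ hj => by
    simp only [Finset.mem_filter] at hj ⊢
    exact ⟨hj.1, hj.2.1, hj.2.2.1⟩

/-- Truncating a sum over the visits after the `n`-th visit stops it at any time with `n`
visits. -/
theorem sum_truncated_eq (h : ℕ → Traj S A T) {k K : ℕ} (hk : 1 ≤ k) (hkK : k ≤ K) (t : Fin T)
    (s : S) (a : A) (f : S → ℝ) :
    ∑ j ∈ Finset.Ico 1 K, (if (h j).state t = s ∧ (h j).action t = a ∧
        visits h j t s a < visits h k t s a then f ((h j).next t) else 0)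
      = ∑ j ∈ Finset.Ico 1 k,
        if (h j).state t = s ∧ (h j).action t = a then f ((h j).next t) else 0 := by
  rw [← Finset.sum_Ico_consecutive _ hk hkK]
  have h2 : ∑ j ∈ Finset.Ico k K, (if (h j).state t = s ∧ (h j).action t = a ∧
        visits h j t s a < visits h k t s a then f ((h j).next t) else 0) = 0 := by
    -- From episode `k` on, the count has already reached its value at `k`, so the truncation
    -- removes every term.
    refine Finset.sum_eq_zero fun j hj => if_neg fun hc => ?_
    exact absurd (visits_mono h (Finset.mem_Ico.1 hj).1 t s a) (not_le.2 hc.2.2)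
  rw [h2, add_zero]
  refine Finset.sum_congr rfl fun j hj => ?_
  obtain ⟨hj1, hjk⟩ := Finset.mem_Ico.1 hj
  by_cases hc : (h j).state t = s ∧ (h j).action t = a
  -- A visit before `k` raises the count, hence occurs strictly below the count at `k` and survives
  -- the truncation.
  · have h3 : visits h (j + 1) t s a = visits h j t s a + 1 := by
      rw [visits_eq_sum, Finset.sum_Ico_succ_top hj1, if_pos hc, ← visits_eq_sum]
    have h4 := visits_mono h (show j + 1 ≤ k from hjk) t s a
    rw [if_pos hc, if_pos ⟨hc.1, hc.2, by omega⟩]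
  · rw [if_neg hc, if_neg fun h' => hc ⟨h'.1, h'.2.1⟩]

theorem sum_visit_indicator (h : ℕ → Traj S A T) (k : ℕ) (t : Fin T) (s : S) (a : A) (s' : S)
    (c d : ℝ) :
    ∑ j ∈ Finset.Ico 1 k, (if (h j).state t = s ∧ (h j).action t = a then
        c * (if (h j).next t = s' then 1 else 0) + d else 0)
      = c * visitsNext h k t s a s' + d * visits h k t s a := by
  rw [visitsNext, visits, Finset.card_filter, Finset.card_filter]
  push_cast
  rw [Finset.mul_sum, Finset.mul_sum, ← Finset.sum_add_distrib]
  refine Finset.sum_congr rfl fun j _ => ?_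
  by_cases h1 : (h j).state t = s <;> by_cases h2 : (h j).action t = a <;>
    by_cases h3 : (h j).next t = s' <;> simp [h1, h2, h3]

end Counting

/-! ### Mean and variance of a signed centred indicator -/

section Indicator

theorem sum_mul_indicator_sub {ι : Type*} [Fintype ι] [DecidableEq ι] {P : ι → ℝ}
    (hP : P ∈ stdSimplex ℝ ι) (i₀ : ι) (σ : ℝ) :
    ∑ i, P i * (σ * ((if i = i₀ then 1 else 0) - P i₀)) = 0 := by
  have : ∀ i, P i * (σ * ((if i = i₀ then 1 else 0) - P i₀))
      = σ * ((if i = i₀ then P i else 0) - P i * P i₀) := fun i => by split_ifs <;> ring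
  simp only [this]
  rw [← Finset.mul_sum, Finset.sum_sub_distrib, ← Finset.sum_mul, hP.2]
  simp

theorem sum_mul_indicator_sub_sq {ι : Type*} [Fintype ι] [DecidableEq ι] {P : ι → ℝ}
    (hP : P ∈ stdSimplex ℝ ι) (i₀ : ι) {σ : ℝ} (hσ : σ ^ 2 = 1) :
    ∑ i, P i * (σ * ((if i = i₀ then 1 else 0) - P i₀)) ^ 2 = P i₀ * (1 - P i₀) := by
  have : ∀ i, P i * (σ * ((if i = i₀ then 1 else 0) - P i₀)) ^ 2
      = (if i = i₀ then P i * (1 - 2 * P i₀) else 0) + P i * P i₀ ^ 2 := fun i => by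
    rw [mul_pow, hσ]; split_ifs <;> ring
  simp only [this]
  rw [Finset.sum_add_distrib, ← Finset.sum_mul, hP.2]
  simp
  ring

end Indicator

/-! ### Exponential supermartingales along the run -/

section Tail

variable {S A Ω : Type*} [Fintype S] [Fintype A] [DecidableEq S] [DecidableEq A] {T : ℕ}
  {mΩ : MeasurableSpace Ω} {ℙ : Measure Ω} {M : MDP S A T}
  {πbase : Fin T → S → A → ℝ} {B₀ δ : ℝ} {K K₀ : ℕ} {ℋ : Filtration ℕ mΩ}
  {traj : ℕ → Ω → Traj S A T} {b : ℕ → Ω → ℝ} {pol : ℕ → Ω → Fin T → S → A → ℝ}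

theorem IsRun.measurableSet_traj (run : IsRun ℙ M πbase B₀ δ K K₀ ℋ traj b pol) {i j : ℕ}
    (hi : i ∈ Finset.Icc 1 K) (hij : i < j) (p : Traj S A T → Prop) :
    MeasurableSet[ℋ j] {ω | p (traj i ω)} := by
  have : {ω | p (traj i ω)} = ⋃ τ ∈ {τ | p τ}, {ω | traj i ω = τ} := by
    ext ω; simp
  rw [this]
  exact ℋ.mono (Nat.succ_le_of_lt hij) _
    (MeasurableSet.biUnion (Set.toFinite _).countable fun τ _ => run.traj_measurable i hi τ)

theorem IsRun.measurable_eval_traj (run : IsRun ℙ M πbase B₀ δ K K₀ ℋ traj b pol) {i j : ℕ}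
    (hi : i ∈ Finset.Icc 1 K) (hij : i < j) {f : Ω → Traj S A T → ℝ}
    (hf : ∀ τ, Measurable[ℋ j] fun ω => f ω τ) :
    Measurable[ℋ j] fun ω => f ω (traj i ω) := by
  classical
  have : (fun ω => f ω (traj i ω))
      = fun ω => ∑ τ : Traj S A T, if traj i ω = τ then f ω τ else 0 := by
    funext ω; simp
  rw [this]
  refine Finset.measurable_sum _ fun τ _ => ?_
  exact Measurable.ite (run.measurableSet_traj hi hij fun τ' => τ' = τ) (hf τ) measurable_const

theorem IsRun.measurable_visits (run : IsRun ℙ M πbase B₀ δ K K₀ ℋ traj b pol) {k : ℕ}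
    (hk : k ≤ K + 1) (t : Fin T) (s : S) (a : A) :
    Measurable[ℋ k] fun ω => visits (fun j => traj j ω) k t s a := by
  simp only [visits_eq_sum]
  refine Finset.measurable_sum _ fun j hj => ?_
  obtain ⟨hj1, hjk⟩ := Finset.mem_Ico.1 hj
  exact Measurable.ite (run.measurableSet_traj (Finset.mem_Icc.2 ⟨hj1, by omega⟩) hjk
    fun τ => τ.state t = s ∧ τ.action t = a) measurable_const measurable_const

variable [IsProbabilityMeasure ℙ]

/-- Replace the indicator of a trajectory by its conditional probability. -/
theorem IsRun.integral_mul_indicator (run : IsRun ℙ M πbase B₀ δ K K₀ ℋ traj b pol) {k : ℕ}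
    (hk : k ∈ Finset.Icc 1 K) (τ : Traj S A T) {G : Ω → ℝ} (hG : Measurable[ℋ k] G) {c : ℝ}
    (hc : ∀ ω, |G ω| ≤ c) :
    Integrable (fun ω => G ω * Set.indicator {ω | traj k ω = τ} (fun _ => (1 : ℝ)) ω) ℙ ∧
    Integrable (fun ω => G ω * trajProb M.init M.trans (pol k ω) τ) ℙ ∧
    ∫ ω, G ω * Set.indicator {ω | traj k ω = τ} (fun _ => (1 : ℝ)) ω ∂ℙ
      = ∫ ω, G ω * trajProb M.init M.trans (pol k ω) τ ∂ℙ := by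
  set I : Ω → ℝ := Set.indicator {ω | traj k ω = τ} (fun _ => (1 : ℝ)) with hI
  have hmeas : MeasurableSet {ω | traj k ω = τ} := ℋ.le _ _ (run.traj_measurable k hk τ)
  have hIint : Integrable I ℙ := (integrable_const 1).indicator hmeas
  have hGI : Integrable (G * I) ℙ :=
    hIint.bdd_mul (hG.mono (ℋ.le k) le_rfl).aestronglyMeasurable (.of_forall hc)
  have h1 : ℙ[G * I | ℋ k] =ᵐ[ℙ] fun ω => G ω * trajProb M.init M.trans (pol k ω) τ := by
    refine (condExp_mul_of_stronglyMeasurable_left hG.stronglyMeasurable hGI hIint).trans ?_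
    filter_upwards [run.law k hk τ] with ω hω
    simp only [Pi.mul_apply]
    rw [hω]
  refine ⟨hGI, integrable_condExp.congr h1, ?_⟩
  rw [← integral_congr_ae h1, integral_condExp (ℋ.le k)]
  rfl

/-- The increment has the past and the new trajectory as separate arguments, so its conditional
exponential moment is the finite sum `trajExp`. Conditioning on `ℋ m` removes the last factor; the
bound `c` serves integrability only. -/
theorem IsRun.integral_exp_sum_le_one (run : IsRun ℙ M πbase B₀ δ K K₀ ℋ traj b pol)
    {Y : ℕ → Ω → Traj S A T → ℝ} {c : ℝ} {m : ℕ} (hm1 : 1 ≤ m) (hmK : m ≤ K + 1)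
    (hY : ∀ j ∈ Finset.Ico 1 m, ∀ τ, Measurable[ℋ j] fun ω => Y j ω τ)
    (hc : ∀ j ω τ, |Y j ω τ| ≤ c)
    (hexp : ∀ j ∈ Finset.Ico 1 m, ∀ ω,
      trajExp M.init M.trans (pol j ω) (fun τ => Real.exp (Y j ω τ)) ≤ 1) :
    Integrable (fun ω => Real.exp (∑ j ∈ Finset.Ico 1 m, Y j ω (traj j ω))) ℙ ∧
    ∫ ω, Real.exp (∑ j ∈ Finset.Ico 1 m, Y j ω (traj j ω)) ∂ℙ ≤ 1 := by
  classical
  induction m, hm1 using Nat.le_induction with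
  | base => simp
  | succ m hm1 ih =>
    have hsub : ∀ j ∈ Finset.Ico 1 m, j ∈ Finset.Ico 1 (m + 1) := fun j hj =>
      Finset.Ico_subset_Ico_right (Nat.le_succ m) hj
    obtain ⟨ihint, ihle⟩ := ih (by omega) (fun j hj => hY j (hsub j hj))
      fun j hj => hexp j (hsub j hj)
    have hmI : m ∈ Finset.Icc 1 K := Finset.mem_Icc.2 ⟨hm1, by omega⟩
    have hmI' : m ∈ Finset.Ico 1 (m + 1) := Finset.mem_Ico.2 ⟨hm1, by omega⟩
    set Z : Ω → ℝ := fun ω => Real.exp (∑ j ∈ Finset.Ico 1 m, Y j ω (traj j ω)) with hZ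
    have hZmeas : Measurable[ℋ m] Z := by
      refine Real.measurable_exp.comp (Finset.measurable_sum _ fun j hj => ?_)
      obtain ⟨hj1, hjm⟩ := Finset.mem_Ico.1 hj
      exact run.measurable_eval_traj (Finset.mem_Icc.2 ⟨hj1, by omega⟩) hjm
        fun τ => (hY j (hsub j hj) τ).mono (ℋ.mono hjm.le) le_rfl
    have hZb : ∀ ω, Z ω ≤ Real.exp (∑ _j ∈ Finset.Ico 1 m, c) := fun ω =>
      Real.exp_le_exp.2 (Finset.sum_le_sum fun j _ => (le_abs_self _).trans (hc j ω _))
    have hG := fun τ : Traj S A T => run.integral_mul_indicator hmI τ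
      (G := fun ω => Z ω * Real.exp (Y m ω τ))
      (hZmeas.mul (Real.measurable_exp.comp (hY m hmI' τ)))
      (c := Real.exp (∑ _j ∈ Finset.Ico 1 m, c) * Real.exp c) (fun ω => by
        rw [abs_of_nonneg (mul_nonneg (Real.exp_pos _).le (Real.exp_pos _).le)]
        exact mul_le_mul (hZb ω) (Real.exp_le_exp.2 ((le_abs_self _).trans (hc m ω τ)))
          (Real.exp_pos _).le (Real.exp_pos _).le)
    have heq : (fun ω => Real.exp (∑ j ∈ Finset.Ico 1 (m + 1), Y j ω (traj j ω)))
        = fun ω => ∑ τ, Z ω * Real.exp (Y m ω τ)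
          * Set.indicator {ω | traj m ω = τ} (fun _ => (1 : ℝ)) ω := by
      funext ω
      rw [Finset.sum_Ico_succ_top hm1, Real.exp_add]
      simp only [Set.indicator_apply, Set.mem_ofPred_eq, mul_ite, mul_one, mul_zero]
      rw [Finset.sum_ite_eq]
      simp [hZ]
    rw [heq]
    refine ⟨integrable_finsetSum _ fun τ _ => (hG τ).1, ?_⟩
    rw [integral_finsetSum _ fun τ _ => (hG τ).1]
    simp only [(hG _).2.2]
    rw [← integral_finsetSum _ fun τ _ => (hG τ).2.1]
    refine le_trans (integral_mono (integrable_finsetSum _ fun τ _ => (hG τ).2.1) ihint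
      fun ω => ?_) ihle
    have h1 := mul_le_mul_of_nonneg_left (hexp m hmI' ω) (Real.exp_pos
      (∑ j ∈ Finset.Ico 1 m, Y j ω (traj j ω))).le
    rw [mul_one, trajExp, Finset.mul_sum] at h1
    refine le_trans (le_of_eq (Finset.sum_congr rfl fun τ _ => ?_)) h1
    simp only [hZ]
    ring

/-- Exponential supermartingale tail bound for sums along the run. -/
theorem IsRun.measureReal_sum_ge_le (run : IsRun ℙ M πbase B₀ δ K K₀ ℋ traj b pol)
    {Y : ℕ → Ω → Traj S A T → ℝ} {c : ℝ} {m : ℕ} (hm1 : 1 ≤ m) (hmK : m ≤ K + 1)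
    (hY : ∀ j ∈ Finset.Ico 1 m, ∀ τ, Measurable[ℋ j] fun ω => Y j ω τ)
    (hc : ∀ j ω τ, |Y j ω τ| ≤ c)
    (hexp : ∀ j ∈ Finset.Ico 1 m, ∀ ω,
      trajExp M.init M.trans (pol j ω) (fun τ => Real.exp (Y j ω τ)) ≤ 1) (x : ℝ) :
    ℙ.real {ω | x ≤ ∑ j ∈ Finset.Ico 1 m, Y j ω (traj j ω)} ≤ Real.exp (-x) := by
  obtain ⟨hint, hle⟩ := run.integral_exp_sum_le_one hm1 hmK hY hc hexp
  have h1 := mul_meas_ge_le_integral_of_nonneg (.of_forall fun ω => (Real.exp_pos _).le) hint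
    (Real.exp x)
  simp only [Real.exp_le_exp] at h1
  rw [Real.exp_neg, ← one_div, le_div_iff₀ (Real.exp_pos x), mul_comm]
  exact h1.trans hle

/-- Lower tail of the number of visits of a pair in the warm-up phase. -/
theorem IsRun.warmup_visits_tail (run : IsRun ℙ M πbase B₀ δ K K₀ ℋ traj b pol) (hK : K₀ ≤ K)
    (hbase : IsPolicy πbase) (t : Fin T) (s : S) (a : A) (x : ℝ) :
    ℙ.real {ω | x ≤ K₀ * visitProb M.init M.trans πbase t s a / 2
      - visits (fun j => traj j ω) (K₀ + 1) t s a} ≤ Real.exp (-x) := by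
  set w := visitProb M.init M.trans πbase t s a with hw
  have hw0 : 0 ≤ w := visitProb_nonneg M.init_mem M.trans_mem hbase t s a
  -- Half the mean minus the visit indicator: its exponential moment is `e^{w/2} (1 - w (1 -
  -- e^{-1})) ≤ e^{w/2} (1 - w/2) ≤ 1`.
  let Y : ℕ → Ω → Traj S A T → ℝ := fun _ _ τ =>
    w / 2 - if τ.state t = s ∧ τ.action t = a then 1 else 0
  have hmain := run.measureReal_sum_ge_le (Y := Y) (c := w / 2 + 1) (m := K₀ + 1)
    (by omega) (by omega) (fun j _ τ => measurable_const) (fun j ω τ => by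
      simp only [Y, abs_le]
      split_ifs <;> constructor <;> linarith) (fun j hj ω => ?_) x
  · refine le_trans (le_of_eq ?_) hmain
    congr 1
    ext ω
    simp only [Set.mem_ofPred_eq, Y, Finset.sum_sub_distrib, Finset.sum_const, Nat.card_Ico,
      visits_eq_sum, nsmul_eq_mul]
    push_cast
    simp [mul_div_assoc]
  · obtain ⟨hj1, hjK⟩ := Finset.mem_Ico.1 hj
    rw [run.warmup j (Finset.mem_Icc.2 ⟨hj1, by omega⟩) (by omega) ω]
    have h1 : (fun τ : Traj S A T => Real.exp (Y j ω τ)) = fun τ =>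
        (1 + (if τ.state t = s ∧ τ.action t = a then 1 else 0) * (Real.exp (-1) - 1))
          * Real.exp (w / 2) := by
      funext τ
      simp only [Y]
      split_ifs
      · rw [sub_eq_add_neg, Real.exp_add]; ring
      · simp
    rw [h1, trajExp_mul_const, trajExp_add, trajExp_mul_const,
      trajExp_const M.init_mem M.trans_mem hbase, ← visitProb, ← hw]
    have h2 : Real.exp (-1) ≤ 1 / 2 := by
      rw [Real.exp_neg, one_div]
      exact inv_anti₀ (by norm_num) (by linarith [Real.add_one_le_exp (1 : ℝ)])
    have h3 : 1 + w * (Real.exp (-1) - 1) ≤ Real.exp (-(w / 2)) := by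
      have := Real.add_one_le_exp (-(w / 2))
      nlinarith
    calc _ ≤ Real.exp (-(w / 2)) * Real.exp (w / 2) :=
          mul_le_mul_of_nonneg_right h3 (Real.exp_pos _).le
      _ = 1 := by rw [← Real.exp_add]; simp

/-- Bernstein's inequality for the empirical transition frequency at the times with exactly `n`
visits, on the side given by the sign `σ`. -/
theorem IsRun.transition_tail (run : IsRun ℙ M πbase B₀ δ K K₀ ℋ traj b pol)
    (t : Fin T) (s : S) (a : A) (s' : S) {σ : ℝ} (hσ : σ = 1 ∨ σ = -1) {n : ℕ} (hn : 1 ≤ n)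
    {x : ℝ} (hx : 0 < x) :
    ∃ B : Set Ω, ℙ.real B ≤ Real.exp (-x) ∧ ∀ ω, ω ∉ B → ∀ k ∈ Finset.Icc 1 K,
      visits (fun j => traj j ω) k t s a = n →
      ∀ D, D = σ * (empTrans (fun j => traj j ω) k t s a s' - M.trans t s a s') → 0 ≤ D →
        D ^ 2 ≤ 2 * (x / n) * (M.trans t s a s' * (1 - M.trans t s a s') + x / n / 2)
          + 2 / 3 * (x / n) * D := by
  have hn0 : (0 : ℝ) < n := by exact_mod_cast hn
  set p := M.trans t s a s' with hp
  have hp0 : 0 ≤ p := (M.trans_mem t s a).1 s'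
  have hp1 : p ≤ 1 := (mem_Icc_of_mem_stdSimplex (M.trans_mem t s a) s').2
  set y := x / n with hy
  have hy0 : 0 < y := by positivity
  have hσ2 : σ ^ 2 = 1 := by rcases hσ with rfl | rfl <;> norm_num
  have hσabs : |σ| = 1 := by rcases hσ with rfl | rfl <;> simp
  -- The extra `y / 2` keeps the variance proxy positive when `p` is `0` or `1`.
  set v := p * (1 - p) + y / 2 with hv
  have hv0 : 0 < v := by nlinarith [mul_nonneg hp0 (sub_nonneg.2 hp1)]
  obtain ⟨r, l, hr0, hl0, hl3, hr, hrate⟩ := exists_bernstein_exponent hv0 hy0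
  set ψ := v * (l ^ 2 / (2 * (1 - l / 3))) with hψ
  -- Only the first `n` visits contribute. At any episode with count `n` the sum over all `K`
  -- episodes is the sum up to that episode, so one event serves all such `k` with a deterministic
  -- `l`.
  let Y : ℕ → Ω → Traj S A T → ℝ := fun j ω τ =>
    if τ.state t = s ∧ τ.action t = a ∧ visits (fun i => traj i ω) j t s a < n then
      (l * σ) * (if τ.next t = s' then 1 else 0) + (-(l * σ * p) - ψ) else 0
  have hψ0 : 0 ≤ ψ := mul_nonneg hv0.le (div_nonneg (sq_nonneg _) (by linarith))
  have hYb : ∀ j ω τ, |Y j ω τ| ≤ l + (l + ψ) := by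
    intro j ω τ
    simp only [Y]
    split_ifs
    · have h1 : |l * σ * 1| ≤ l := by rw [mul_one, abs_mul, hσabs, mul_one, abs_of_pos hl0]
      have h2 : |-(l * σ * p) - ψ| ≤ l + ψ := by
        refine (abs_sub _ _).trans ?_
        rw [abs_neg, abs_mul, abs_mul, hσabs, abs_of_pos hl0, abs_of_nonneg hp0,
          abs_of_nonneg hψ0]
        nlinarith
      exact (abs_add_le _ _).trans (add_le_add h1 h2)
    · rw [mul_zero, zero_add]
      refine (abs_sub _ _).trans ?_
      rw [abs_neg, abs_mul, abs_mul, hσabs, abs_of_pos hl0, abs_of_nonneg hp0,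
        abs_of_nonneg hψ0]
      nlinarith
    · rw [abs_zero]; linarith
  refine ⟨{ω | x ≤ ∑ j ∈ Finset.Ico 1 (K + 1), Y j ω (traj j ω)},
    run.measureReal_sum_ge_le (by omega) le_rfl (fun j hj τ => ?_) hYb (fun j hj ω => ?_) x, ?_⟩
  · obtain ⟨hj1, hjK⟩ := Finset.mem_Ico.1 hj
    exact (measurable_from_top (f := fun i : ℕ =>
      if τ.state t = s ∧ τ.action t = a ∧ i < n then
        (l * σ) * (if τ.next t = s' then 1 else 0) + (-(l * σ * p) - ψ) else 0)).comp
      (run.measurable_visits hjK.le t s a)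
  · have hjI : j ∈ Finset.Icc 1 K := by
      simp only [Finset.mem_Ico, Finset.mem_Icc] at hj ⊢; omega
    have hpol := run.pol_isPolicy j hjI ω
    have h1 := trajExp_next (μ := M.init) M.trans_mem hpol t (fun x u x' => Real.exp
      (if x = s ∧ u = a ∧ visits (fun i => traj i ω) j t s a < n then
        (l * σ) * (if x' = s' then 1 else 0) + (-(l * σ * p) - ψ) else 0))
    change trajExp M.init M.trans (pol j ω) (fun τ => Real.exp (Y j ω τ)) = _ at h1
    rw [h1]
    refine (trajExp_mono M.init_mem M.trans_mem hpol (G := fun _ => 1) fun τ => ?_).trans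
      (trajExp_const M.init_mem M.trans_mem hpol 1).le
    by_cases hc : τ.state t = s ∧ τ.action t = a ∧ visits (fun i => traj i ω) j t s a < n
    · simp only [hc, and_self, if_true]
      have hbern := sum_mul_exp_le_exp (M.trans_mem t s a)
        (x := fun i => σ * ((if i = s' then 1 else 0) - M.trans t s a s')) (l := l) (v := v)
        (fun i => by
          rcases hσ with rfl | rfl <;> split_ifs <;> linarith)
        (sum_mul_indicator_sub (M.trans_mem t s a) s' σ)
        (by rw [sum_mul_indicator_sub_sq (M.trans_mem t s a) s' hσ2]; linarith) hl0.le hl3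
      rw [← hψ] at hbern
      calc _ = (∑ i, M.trans t s a i * Real.exp
            (l * (σ * ((if i = s' then 1 else 0) - M.trans t s a s')))) * Real.exp (-ψ) := by
            rw [Finset.sum_mul]
            refine Finset.sum_congr rfl fun i _ => ?_
            rw [mul_assoc (M.trans t s a i), ← Real.exp_add]
            congr 2
            ring
        _ ≤ Real.exp ψ * Real.exp (-ψ) := mul_le_mul_of_nonneg_right hbern (Real.exp_pos _).le
        _ = 1 := by rw [← Real.exp_add]; simp
    · simp only [hc, if_false, Real.exp_zero, mul_one]
      exact (M.trans_mem _ _ _).2.le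
  · intro ω hω k hk hvis D hD hD0
    obtain ⟨hk1, hkK⟩ := Finset.mem_Icc.1 hk
    simp only [Set.mem_ofPred_eq, not_le] at hω
    have hsum : ∑ j ∈ Finset.Ico 1 (K + 1), Y j ω (traj j ω)
        = (l * σ) * visitsNext (fun j => traj j ω) k t s a s' + (-(l * σ * p) - ψ) * n := by
      have h1 := sum_truncated_eq (fun j => traj j ω) hk1 (hkK.trans (Nat.le_succ K)) t s a
        (fun z => (l * σ) * (if z = s' then 1 else 0) + (-(l * σ * p) - ψ))
      rw [sum_visit_indicator (fun j => traj j ω), hvis] at h1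
      exact h1
    have hemp : (visitsNext (fun j => traj j ω) k t s a s' : ℝ)
        = n * empTrans (fun j => traj j ω) k t s a s' := by
      rw [empTrans, hvis, max_eq_left (by exact_mod_cast hn), mul_div_cancel₀ _ hn0.ne']
    rw [hsum, hemp] at hω
    -- Off the bad event the sum `n (l D - ψ)` is below `x = n y`, and `y` is the rate `l r - ψ`.
    have h2 : n * (l * D - ψ) < n * (l * r - ψ) := by
      rw [hrate, hy, mul_div_cancel₀ _ hn0.ne', hD]
      linarith
    have h3 : D ≤ r := by
      have := lt_of_mul_lt_mul_left h2 hn0.le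
      exact (lt_of_mul_lt_mul_left (by linarith : l * D < l * r) hl0.le).le
    -- `r` satisfies the bound with equality. Below `2 y / 3` the bound is trivial; above, `D (D - 2
    -- y / 3)` is increasing, so `D ≤ r` suffices.
    by_cases h4 : D ≤ 2 / 3 * y
    · nlinarith [mul_pos hy0 hv0]
    · nlinarith

end Tail

/-! ### The logarithmic factor -/

section LogFactor

variable {S A : Type*} [Fintype S] [Fintype A] [Nonempty S] [Nonempty A] {T K : ℕ} {δ : ℝ}

theorem exp_neg_logFactor (hT : 0 < T) (hK : 0 < K) (hδ : 0 < δ) :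
    Real.exp (-logFactor S A T K δ)
      = δ / (2 * (Fintype.card S : ℝ) * (Fintype.card A : ℝ) * (T : ℝ) * (K : ℝ)) := by
  have hS : (0 : ℝ) < Fintype.card S := by exact_mod_cast Fintype.card_pos
  have hA : (0 : ℝ) < Fintype.card A := by exact_mod_cast Fintype.card_pos
  have hT' : (0 : ℝ) < T := by exact_mod_cast hT
  have hK' : (0 : ℝ) < K := by exact_mod_cast hK
  rw [logFactor, Real.exp_neg, Real.exp_log (by positivity), inv_div]

theorem half_le_logFactor (hT : 0 < T) (hK : 0 < K) (hδ : 0 < δ) (hδ1 : δ < 1) :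
    1 / 2 ≤ logFactor S A T K δ := by
  have hS : (1 : ℝ) ≤ Fintype.card S := by exact_mod_cast Fintype.card_pos
  have hA : (1 : ℝ) ≤ Fintype.card A := by exact_mod_cast Fintype.card_pos
  have hT' : (1 : ℝ) ≤ T := by exact_mod_cast hT
  have hK' : (1 : ℝ) ≤ K := by exact_mod_cast hK
  have h2 : (2 : ℝ) ≤ 2 * (Fintype.card S : ℝ) * (Fintype.card A : ℝ) * (T : ℝ) * (K : ℝ) / δ := by
    rw [le_div_iff₀ hδ]
    have : (1 : ℝ) ≤ (Fintype.card S : ℝ) * (Fintype.card A : ℝ) * (T : ℝ) * (K : ℝ) :=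
      one_le_mul_of_one_le_of_one_le (one_le_mul_of_one_le_of_one_le
        (one_le_mul_of_one_le_of_one_le hS hA) hT') hK'
    linarith
  have h3 := Real.log_le_log (by norm_num) h2
  have h4 := Real.log_two_gt_d9
  rw [logFactor]
  linarith

end LogFactor

/-! ### Probabilities of the good events and safety on them -/

section Main

variable {S A Ω : Type*} [Fintype S] [Fintype A] [DecidableEq S] [DecidableEq A] {T : ℕ}
  {mΩ : MeasurableSpace Ω} {ℙ : Measure Ω} {M : MDP S A T}
  {πbase : Fin T → S → A → ℝ} {B₀ δ : ℝ} {K K₀ : ℕ} {ℋ : Filtration ℕ mΩ}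
  {traj : ℕ → Ω → Traj S A T} {b : ℕ → Ω → ℝ} {pol : ℕ → Ω → Fin T → S → A → ℝ}

theorem MDP.consumption_nonneg (M : MDP S A T) {π : Fin T → S → A → ℝ} (hπ : IsPolicy π) :
    0 ≤ M.consumption π := by
  rw [MDP.consumption, value_eq_sum_visitProb]
  exact Finset.sum_nonneg fun t _ => Finset.sum_nonneg fun s _ => Finset.sum_nonneg fun a _ =>
    mul_nonneg (visitProb_nonneg M.init_mem M.trans_mem hπ t s a) (M.cost_mem t s a).1

/-- Safety on the good events. -/
theorem IsRun.consumption_le (run : IsRun ℙ M πbase B₀ δ K K₀ ℋ traj b pol)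
    (hbase : IsPolicy πbase) (hslack : M.consumption πbase < B₀) (hT : 0 < T)
    (hγT : B₀ - M.consumption πbase ≤ T) (hL : 1 / 2 ≤ logFactor S A T K δ) (hK₀ : 0 < K₀)
    (hwarm : 100 * ((Fintype.card S : ℝ) ^ 2 * (Fintype.card A : ℝ) * (T : ℝ) ^ 4
      / (B₀ - M.consumption πbase) ^ 2) * logFactor S A T K δ ^ 2 ≤ (K₀ : ℝ)) {ω : Ω} {k : ℕ}
    (hk : k ∈ Finset.Icc 1 K)
    (hconf : ∀ t s a s', |empTrans (fun j => traj j ω) k t s a s' - M.trans t s a s'|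
        ≤ radius K δ (fun j => traj j ω) k t s a s')
    (hvis : ∀ t s a, K₀ * visitProb M.init M.trans πbase t s a / 2 - logFactor S A T K δ
        ≤ visits (fun j => traj j ω) (K₀ + 1) t s a) :
    M.consumption (pol k ω) ≤ b k ω := by
  rcases le_or_gt k K₀ with hkK | hkK
  · rw [run.warmup k hk hkK ω]
    exact hslack.le.trans (run.budget_mem k hk ω).1
  · have hinf := inflation_le (h := fun j => traj j ω) (k := k) hbase hT hL (sub_pos.2 hslack) hγT
      (by exact_mod_cast hK₀) hwarm fun t s a => (hvis t s a).trans
        (by exact_mod_cast visits_mono _ (show K₀ + 1 ≤ k from hkK) t s a)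
    -- The inflation is at most `B₀ - b_base`, so the baseline's inflated consumption is at most `B₀
    -- ≤ b k ω`.
    have hfeas := lpFeasible_occupancy M (b := b k ω) hbase hconf
      (by linarith [(run.budget_mem k hk ω).1])
    obtain ⟨q, hq, hind⟩ := run.solve k hk hkK ω ⟨_, hfeas⟩
    exact consumption_le_of_lpFeasible M (run.pol_isPolicy k hk ω) hconf hq.1 hind

variable [IsProbabilityMeasure ℙ]

/-- All confidence intervals hold with probability at least `1 - δ`. -/
theorem IsRun.confidence (run : IsRun ℙ M πbase B₀ δ K K₀ ℋ traj b pol)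
    [Nonempty S] [Nonempty A] (hT : 0 < T) (hδ : 0 < δ) (hδ1 : δ < 1) (hK : 0 < K)
    (hcard : (Fintype.card S : ℝ) ^ 2 ≤ K) :
    ∃ B : Set Ω, ℙ.real B ≤ δ ∧ ∀ ω, ω ∉ B → ∀ k ∈ Finset.Icc 1 K, ∀ t s a s',
      |empTrans (fun j => traj j ω) k t s a s' - M.trans t s a s'|
        ≤ radius K δ (fun j => traj j ω) k t s a s' := by
  have hL := half_le_logFactor (S := S) (A := A) hT hK hδ hδ1
  have hexpL := exp_neg_logFactor (S := S) (A := A) hT hK hδ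
  set L := logFactor S A T K δ with hLdef
  -- Rate `3 L / 2` instead of `L`: the union over next states costs a factor `S` that `e^{-L}` does
  -- not cover. The constants in the radius leave room for it, since `2 · 3/2 ≤ 4` and `3 · 3/2 ≤
  -- 14/3`.
  have hx : 0 < 3 / 2 * L := by linarith
  let sgn : Bool → ℝ := fun c => if c then 1 else -1
  have hsgn : ∀ c, sgn c = 1 ∨ sgn c = -1 := fun c => by cases c <;> simp [sgn]
  have hB := fun i : (Fin T × S × A × S) × (Bool × Fin K) =>
    run.transition_tail i.1.1 i.1.2.1 i.1.2.2.1 i.1.2.2.2 (hsgn i.2.1)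
      (Nat.succ_le_succ (Nat.zero_le i.2.2.val)) hx
  choose B hBle hBimp using hB
  refine ⟨⋃ i, B i, ?_, fun ω hω k hk t s a s' => ?_⟩
  · refine (measureReal_iUnion_fintype_le B).trans
      ((Finset.sum_le_sum fun i _ => hBle i).trans ?_)
    rw [Finset.sum_const, Finset.card_univ, nsmul_eq_mul]
    simp only [Fintype.card_prod, Fintype.card_fin, Fintype.card_bool]
    push_cast
    have hS : (1 : ℝ) ≤ Fintype.card S := by exact_mod_cast Fintype.card_pos
    have hA : (1 : ℝ) ≤ Fintype.card A := by exact_mod_cast Fintype.card_pos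
    have hT' : (1 : ℝ) ≤ T := by exact_mod_cast hT
    have hK' : (1 : ℝ) ≤ K := by exact_mod_cast hK
    have h1 : Real.exp (-(3 / 2 * L)) = Real.exp (-L) * Real.exp (-L / 2) := by
      rw [← Real.exp_add]; ring_nf
    -- The additional `e^{-L/2}` pays for the factor `S`, because `S² ≤ K ≤ e^L`.
    have h2 : (Fintype.card S : ℝ) * Real.exp (-L / 2) ≤ 1 := by
      have h3 : (Real.exp (-L / 2)) ^ 2 = Real.exp (-L) := by
        rw [sq, ← Real.exp_add]; ring_nf
      have h4 : ((Fintype.card S : ℝ) * Real.exp (-L / 2)) ^ 2 ≤ 1 := by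
        rw [mul_pow, h3, hexpL, mul_div_assoc', div_le_one (by positivity)]
        have h5 : (1 : ℝ) ≤ (Fintype.card S : ℝ) * Fintype.card A * T :=
          one_le_mul_of_one_le_of_one_le (one_le_mul_of_one_le_of_one_le hS hA) hT'
        nlinarith
      exact (sq_le_one_iff₀ (by positivity)).1 h4
    rw [h1]
    calc _ = (2 * (Fintype.card S : ℝ) * Fintype.card A * T * K * Real.exp (-L))
          * (Fintype.card S * Real.exp (-L / 2)) := by ring
      _ = δ * (Fintype.card S * Real.exp (-L / 2)) := by
          rw [hexpL, mul_div_cancel₀ _ (by positivity)]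
      _ ≤ δ := by nlinarith
  · obtain ⟨hk1, hkK⟩ := Finset.mem_Icc.1 hk
    have hp := mem_Icc_of_mem_stdSimplex (M.trans_mem t s a) s'
    have hq0 := empTrans_nonneg (fun j => traj j ω) k t s a s'
    have hq1 := empTrans_le_one (fun j => traj j ω) k t s a s'
    rcases Nat.eq_zero_or_pos (visits (fun j => traj j ω) k t s a) with hv | hv
    -- Without visits the estimate is `0` and the radius is at least `14 L / 3 ≥ 1`, so the interval
    -- is trivially valid.
    · have hn : visitsNext (fun j => traj j ω) k t s a s' = 0 :=
        Nat.le_zero.1 (hv ▸ visitsNext_le_visits _ k t s a s')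
      rw [radius, empTrans, hn, hv, ← hLdef]
      simp only [Nat.cast_zero, zero_div, zero_sub, abs_neg, abs_of_nonneg hp.1]
      rw [max_eq_right zero_le_one, div_one, div_one]
      have hp1 : M.trans t s a s' ≤ 1 := hp.2
      refine hp1.trans (le_trans ?_ (le_add_of_nonneg_left (Real.sqrt_nonneg _)))
      linarith
    · obtain ⟨c, hc⟩ : ∃ c, |empTrans (fun j => traj j ω) k t s a s' - M.trans t s a s'|
          = sgn c * (empTrans (fun j => traj j ω) k t s a s' - M.trans t s a s') := by
        rcases abs_choice (empTrans (fun j => traj j ω) k t s a s' - M.trans t s a s') with h | h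
        · exact ⟨true, by rw [h]; simp [sgn]⟩
        · exact ⟨false, by rw [h]; simp [sgn]⟩
      have hvK : visits (fun j => traj j ω) k t s a - 1 < K := by
        have : visits (fun j => traj j ω) k t s a ≤ k - 1 := by
          refine (Finset.card_filter_le _ _).trans ?_
          simp
        omega
      have hv' : visits (fun j => traj j ω) k t s a
          = (visits (fun j => traj j ω) k t s a - 1).succ := by omega
      have h1 := hBimp ((t, s, a, s'), (c, ⟨_, hvK⟩)) ω
        (fun h => hω (Set.mem_iUnion.2 ⟨_, h⟩)) k hk hv' _ hc (abs_nonneg _)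
      dsimp only at h1
      rw [← hv'] at h1
      have hn0 : (1 : ℝ) ≤ visits (fun j => traj j ω) k t s a := by exact_mod_cast hv
      refine (abs_sub_le_of_sq_le hp ⟨hq0, hq1⟩ (by positivity) h1).trans ?_
      rw [radius, max_eq_left hn0, ← hLdef]
      refine add_le_add (Real.sqrt_le_sqrt ?_) ?_
      · rw [mul_div_assoc', div_le_div_iff_of_pos_right (by linarith)]
        have := mul_nonneg (mul_nonneg hq0 (sub_nonneg.2 hq1)) (by linarith : 0 ≤ L)
        linarith
      · rw [mul_div_assoc', div_le_div_iff_of_pos_right (by linarith)]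
        linarith

/-- In the warm-up phase every pair is visited about as often as the baseline predicts, with
probability at least `1 - δ`. -/
theorem IsRun.warmup_visits (run : IsRun ℙ M πbase B₀ δ K K₀ ℋ traj b pol)
    [Nonempty S] [Nonempty A] (hT : 0 < T) (hδ : 0 < δ) (hK : 0 < K)
    (hKK : K₀ ≤ K) (hbase : IsPolicy πbase) :
    ∃ B : Set Ω, ℙ.real B ≤ δ ∧ ∀ ω, ω ∉ B → ∀ t s a,
      K₀ * visitProb M.init M.trans πbase t s a / 2 - logFactor S A T K δ
        ≤ visits (fun j => traj j ω) (K₀ + 1) t s a := by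
  have hexpL := exp_neg_logFactor (S := S) (A := A) hT hK hδ
  set L := logFactor S A T K δ
  refine ⟨⋃ i : Fin T × S × A, {ω | L ≤ K₀ * visitProb M.init M.trans πbase i.1 i.2.1 i.2.2 / 2
      - visits (fun j => traj j ω) (K₀ + 1) i.1 i.2.1 i.2.2}, ?_, fun ω hω t s a => ?_⟩
  · refine (measureReal_iUnion_fintype_le _).trans ((Finset.sum_le_sum fun i _ =>
      run.warmup_visits_tail hKK hbase i.1 i.2.1 i.2.2 L).trans ?_)
    rw [Finset.sum_const, Finset.card_univ, nsmul_eq_mul, hexpL]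
    simp only [Fintype.card_prod, Fintype.card_fin]
    push_cast
    have hS : (0 : ℝ) < Fintype.card S := by exact_mod_cast Fintype.card_pos
    have hA : (0 : ℝ) < Fintype.card A := by exact_mod_cast Fintype.card_pos
    have hT' : (0 : ℝ) < T := by exact_mod_cast hT
    have hK' : (1 : ℝ) ≤ K := by exact_mod_cast hK
    rw [mul_div_assoc', div_le_iff₀ (by positivity)]
    have : 0 < (Fintype.card S : ℝ) * Fintype.card A * T * δ := by positivity
    nlinarith
  · by_contra! h
    refine hω (Set.mem_iUnion.2 ⟨(t, s, a), ?_⟩)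
    change L ≤ _
    linarith

end Main

end BALDE

/-! ### The safety theorem -/

theorem theorem2 :
    ∃ C : ℝ, 0 < C ∧
      ∀ (S A Ω : Type*) [Fintype S] [Fintype A] [DecidableEq S] [DecidableEq A]
        {mΩ : MeasurableSpace Ω} (ℙ : Measure Ω) [IsProbabilityMeasure ℙ]
        (T K K₀ : ℕ) (M : BALDE.MDP S A T) (πbase : Fin T → S → A → ℝ) (B₀ δ : ℝ)
        (ℋ : Filtration ℕ mΩ) (traj : ℕ → Ω → BALDE.Traj S A T) (b : ℕ → Ω → ℝ)
        (pol : ℕ → Ω → Fin T → S → A → ℝ),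
        0 < δ → δ < 1 →
        BALDE.IsPolicy πbase →
        M.consumption πbase < B₀ →
        C * ((Fintype.card S : ℝ) ^ 2 * (Fintype.card A : ℝ) * (T : ℝ) ^ 4
            / (B₀ - M.consumption πbase) ^ 2) * BALDE.logFactor S A T K δ ^ 2 ≤ (K₀ : ℝ) →
        BALDE.IsRun ℙ M πbase B₀ δ K K₀ ℋ traj b pol →
        1 - 3 * δ ≤ ℙ.real {ω | ∀ k ∈ Finset.Icc 1 K, M.consumption (pol k ω) ≤ b k ω} := by
  refine ⟨100, by norm_num, ?_⟩
  intro S A Ω _ _ _ _ mΩ ℙ _ T K K₀ M πbase B₀ δ ℋ traj b pol hδ hδ1 hbase hslack hwarm run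
  -- If the warm-up covers the whole run, only the baseline is played and safety is certain.
  rcases le_or_gt K K₀ with hKK | hKK
  · have huniv : {ω | ∀ k ∈ Finset.Icc 1 K, M.consumption (pol k ω) ≤ b k ω} = Set.univ := by
      refine Set.eq_univ_of_forall fun ω k hk => ?_
      rw [run.warmup k hk ((Finset.mem_Icc.1 hk).2.trans hKK) ω]
      exact hslack.le.trans (run.budget_mem k hk ω).1
    rw [huniv, probReal_univ]
    linarith
  have hK : 0 < K := by omega
  obtain ⟨ω₀⟩ : Nonempty Ω := nonempty_of_isProbabilityMeasure ℙ
  have hγ0 : 0 < B₀ - M.consumption πbase := sub_pos.2 hslack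
  -- The budget interval `[B₀, T]` is nonempty and the baseline's consumption is nonnegative.
  have hγT : B₀ - M.consumption πbase ≤ T := by
    have h1 := run.budget_mem 1 (Finset.mem_Icc.2 ⟨le_rfl, hK⟩) ω₀
    linarith [h1.1, h1.2, M.consumption_nonneg hbase]
  have hT : 0 < T := by exact_mod_cast hγ0.trans_le hγT
  obtain ⟨s₀⟩ : Nonempty S := by
    by_contra h
    rw [not_nonempty_iff] at h
    simpa using M.init_mem.2
  have : Nonempty S := ⟨s₀⟩
  have : Nonempty A := by
    by_contra h
    rw [not_nonempty_iff] at h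
    simpa using (hbase ⟨0, hT⟩ s₀).2
  have hL := BALDE.half_le_logFactor (S := S) (A := A) hT hK hδ hδ1
  have hS1 : (1 : ℝ) ≤ Fintype.card S := by exact_mod_cast Fintype.card_pos
  have hA1 : (1 : ℝ) ≤ Fintype.card A := by exact_mod_cast Fintype.card_pos
  have hT1 : (1 : ℝ) ≤ T := by exact_mod_cast hT
  -- The warm-up length dominates `S²`, as `γ ≤ T` and `1/2 ≤ L'`. Together with `K₀ < K` this
  -- supplies the `S² ≤ K` needed for the confidence event.
  have hSK₀ : (Fintype.card S : ℝ) ^ 2 ≤ K₀ := by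
    refine le_trans ?_ hwarm
    have h1 : (1 : ℝ) ≤ (T : ℝ) ^ 4 / (B₀ - M.consumption πbase) ^ 2 := by
      rw [one_le_div (by positivity)]
      calc (B₀ - M.consumption πbase) ^ 2 ≤ (T : ℝ) ^ 2 := by gcongr
        _ ≤ (T : ℝ) ^ 4 := pow_le_pow_right₀ hT1 (by norm_num)
    have h2 : (1 : ℝ) ≤ 100 * BALDE.logFactor S A T K δ ^ 2 := by nlinarith
    calc (Fintype.card S : ℝ) ^ 2 = (Fintype.card S : ℝ) ^ 2 * 1 := (mul_one _).symm
      _ ≤ (Fintype.card S : ℝ) ^ 2 * (Fintype.card A * ((T : ℝ) ^ 4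
          / (B₀ - M.consumption πbase) ^ 2) * (100 * BALDE.logFactor S A T K δ ^ 2)) := by
          gcongr
          exact one_le_mul_of_one_le_of_one_le (one_le_mul_of_one_le_of_one_le hA1 h1) h2
      _ = _ := by ring
  have hK₀ : 0 < K₀ := by
    have : (0 : ℝ) < K₀ := lt_of_lt_of_le (by positivity) hSK₀
    exact_mod_cast this
  obtain ⟨B₁, hB₁, hconf⟩ := run.confidence hT hδ hδ1 hK
    (hSK₀.trans (by exact_mod_cast hKK.le))
  obtain ⟨B₂, hB₂, hvis⟩ := run.warmup_visits hT hδ hK hKK.le hbase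
  -- Covering the whole space and using subadditivity avoids any measurability of the safe event or
  -- of `B₁` and `B₂`.
  have hcover : Set.univ ⊆ {ω | ∀ k ∈ Finset.Icc 1 K, M.consumption (pol k ω) ≤ b k ω}
      ∪ (B₁ ∪ B₂) := by
    intro ω _
    by_cases h : ω ∈ B₁ ∪ B₂
    · exact Or.inr h
    · refine Or.inl fun k hk => ?_
      exact run.consumption_le hbase hslack hT hγT hL hK₀ hwarm hk
        (hconf ω (fun h1 => h (Or.inl h1)) k hk) (hvis ω fun h2 => h (Or.inr h2))
  have h1 : ℙ.real Set.univ ≤ _ := measureReal_mono hcover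
  rw [probReal_univ] at h1
  have h2 := measureReal_union_le (μ := ℙ)
    {ω | ∀ k ∈ Finset.Icc 1 K, M.consumption (pol k ω) ≤ b k ω} (B₁ ∪ B₂)
  have h3 := measureReal_union_le (μ := ℙ) B₁ B₂
  linarith
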